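/- Let $\mathbb O=\mathbb H\oplus\mathbb H$ be the octonions, with multiplication $(q_1,q_2)(p_1,p_2)=(q_1p_1-\bar p_2q_2,\;p_2q_1+q_2\bar p_1)$, conjugation $\overline{(q_1,q_2)}=(\bar q_1,-q_2)$, real part $\mathrm{Re}$ and norm $|a|^2=\mathrm{Re}(a\bar a)$. Let $\mathcal U=U_1\cup U_2\cup U_3\subset\mathbb O^3$ be the set of triples with at least one entry equal to $1$, where $U_i$ consists of the triples whose $i$-th entry is $1$, and let $\mathbb OP^2=\mathcal U/{\sim}$, where $x\sim y$ iff there is $\lambda\in\mathbb O\setminus\{0\}$ with $x_k=y_k\lambda$ for $k=1,2,3$. It is a $16$-dimensional analytic manifold with the charts $\phi_i:U_i/{\sim}\to\mathbb O^2$ $(i=1,2,3)$ given by $[1,u,v]\mapsto(u,v)$, $[u,1,v]\mapsto(u,v)$, $[u,v,1]\mapsto(u,v)$, respectively. (a) There is exactly one smooth Riemannian metric $g$ on $\mathbb OP^2$ which in the coordinates $(u,v)$ of each of the three charts has the form $$ds^2=\frac{|du|^2(1+|v|^2)+|dv|^2(1+|u|^2)-2\,\mathrm{Re}[(u\bar v)(dv\,d\bar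 u)]}{(1+|u|^2+|v|^2)^2}.$$ (b) Let $r\in\mathbb R$ and $\lambda\in\mathbb O$ with $r^2+|\lambda|^2=1$, and let $i\in\{1,2,3\}$. The map $\mathcal R_{r,\lambda}$ of $U_i/{\sim}$ given in the coordinates of $\phi_i$ by $(u,v)\mapsto(ru+\lambda v,\;\bar\lambda u-rv)$ has a unique analytic extension $\widetilde{\mathcal R_{r,\lambda}}:\mathbb OP^2\to\mathbb OP^2$ (a ``reflection''), and this extension is an involutive isometry of $(\mathbb OP^2,g)$. Consequently, for every $t\in\mathbb R$, the ``rotation'' $\mathcal I_t=\widetilde{\mathcal R_{1,0}}\circ\widetilde{\mathcal R_{\cos t,\sin t}}$, formed with the reflections of $U_3/{\sim}$, is well defined. (c) Every finite composition of reflections $\widetilde{\mathcal R_{r,\lambda}}$ of $U_1/{\sim}$ (with $r^2+|\lambda|^2=1$) and rotations $\mathcal I_t$ is an isometry of $(\mathbb OP^2,g)$, and for every point $p\in\mathbb OP^2$ some such composition takes $[1,0,0]$ to $p$. (d) $(\mathbb OP^2,g)$ is homogeneous: for all $p,q\in\mathbb OP^2$ there is an isometry of $(\mathbb OP^2,g)$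 taking $p$ to $q$. Here an isometry is a diffeomorphism of $\mathbb OP^2$ onto itself that preserves $g$. -/

import Mathlib

open scoped Quaternion Manifold ContDiff

noncomputable section

/-! ### The octonions -/

/-- The octonions `𝕆 = ℍ ⊕ ℍ`, with the Euclidean norm `|(q₁, q₂)|² = |q₁|² + |q₂|²`. -/
def Octonion : Type := WithLp 2 (ℍ[ℝ] × ℍ[ℝ])

namespace Octonion

instance : NormedAddCommGroup Octonion :=
  inferInstanceAs (NormedAddCommGroup (WithLp 2 (ℍ[ℝ] × ℍ[ℝ])))

instance : InnerProductSpace ℝ Octonion :=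
  inferInstanceAs (InnerProductSpace ℝ (WithLp 2 (ℍ[ℝ] × ℍ[ℝ])))

/-- The octonion `(q₁, q₂)`. -/
def mk (q₁ q₂ : ℍ[ℝ]) : Octonion := WithLp.toLp 2 (q₁, q₂)

/-- First quaternionic component. -/
def fst (a : Octonion) : ℍ[ℝ] := (WithLp.ofLp a).1

/-- Second quaternionic component. -/
def snd (a : Octonion) : ℍ[ℝ] := (WithLp.ofLp a).2

instance : One Octonion := ⟨mk 1 0⟩

/-- Cayley-Dickson multiplication. -/
instance : Mul Octonion :=
  ⟨fun a b => mk (a.fst * b.fst - star b.snd * a.snd) (b.snd * a.fst + a.snd * star b.fst)⟩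

/-- Octonionic conjugation. -/
instance : Star Octonion := ⟨fun a => mk (star a.fst) (-a.snd)⟩

/-- The real part. -/
def re (a : Octonion) : ℝ := a.fst.re

/-- The inverse `a⁻¹ = |a|⁻² ā` (and `0⁻¹ = 0`). -/
instance : Inv Octonion := ⟨fun a => (‖a‖ ^ 2)⁻¹ • star a⟩

@[ext] theorem ext {a b : Octonion} (h₁ : a.fst = b.fst) (h₂ : a.snd = b.snd) : a = b :=
  WithLp.ofLp_injective 2 (Prod.ext h₁ h₂)

@[simp] theorem fst_mk (p q : ℍ[ℝ]) : (mk p q).fst = p := rfl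
@[simp] theorem snd_mk (p q : ℍ[ℝ]) : (mk p q).snd = q := rfl
@[simp] theorem fst_zero : (0 : Octonion).fst = 0 := rfl
@[simp] theorem snd_zero : (0 : Octonion).snd = 0 := rfl
@[simp] theorem fst_one : (1 : Octonion).fst = 1 := rfl
@[simp] theorem snd_one : (1 : Octonion).snd = 0 := rfl
@[simp] theorem fst_add (a b : Octonion) : (a + b).fst = a.fst + b.fst := rfl
@[simp] theorem snd_add (a b : Octonion) : (a + b).snd = a.snd + b.snd := rfl
@[simp] theorem fst_smul (c : ℝ) (a : Octonion) : (c • a).fst = c • a.fst := rfl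
@[simp] theorem snd_smul (c : ℝ) (a : Octonion) : (c • a).snd = c • a.snd := rfl
@[simp] theorem fst_mul (a b : Octonion) :
    (a * b).fst = a.fst * b.fst - star b.snd * a.snd := rfl
@[simp] theorem snd_mul (a b : Octonion) :
    (a * b).snd = b.snd * a.fst + a.snd * star b.fst := rfl
@[simp] theorem fst_star (a : Octonion) : (star a).fst = star a.fst := rfl
@[simp] theorem snd_star (a : Octonion) : (star a).snd = -a.snd := rfl

theorem inv_def (a : Octonion) : a⁻¹ = (‖a‖ ^ 2)⁻¹ • star a := rfl

theorem norm_sq_eq (a : Octonion) :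
    ‖a‖ ^ 2 = Quaternion.normSq a.fst + Quaternion.normSq a.snd := by
  rw [Quaternion.normSq_eq_norm_mul_self, Quaternion.normSq_eq_norm_mul_self, ← sq, ← sq]
  exact WithLp.prod_norm_sq_eq_of_L2 (α := ℍ[ℝ]) (β := ℍ[ℝ]) a

/-- `|a|² = Re (a ā)`. -/
theorem norm_sq_eq_re (a : Octonion) : ‖a‖ ^ 2 = re (a * star a) := by
  rw [norm_sq_eq, Quaternion.normSq_def', Quaternion.normSq_def']
  simp [re]
  ring

theorem one_mul' (a : Octonion) : 1 * a = a := by ext <;> simp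
theorem mul_one' (a : Octonion) : a * 1 = a := by ext <;> simp
theorem mul_zero' (a : Octonion) : a * 0 = 0 := by ext <;> simp
theorem zero_mul' (a : Octonion) : 0 * a = 0 := by ext <;> simp
theorem mul_smul' (c : ℝ) (a b : Octonion) : a * (c • b) = c • (a * b) := by
  ext <;> simp <;> ring
theorem smul_mul' (c : ℝ) (a b : Octonion) : (c • a) * b = c • (a * b) := by
  ext <;> simp <;> ring

theorem mul_mul_star (a b : Octonion) : (b * a) * star a = (‖a‖ ^ 2) • b := by
  rw [norm_sq_eq, Quaternion.normSq_def', Quaternion.normSq_def']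
  ext <;> simp <;> ring

theorem mul_star_mul (a b : Octonion) : (b * star a) * a = (‖a‖ ^ 2) • b := by
  rw [norm_sq_eq, Quaternion.normSq_def', Quaternion.normSq_def']
  ext <;> simp <;> ring

theorem star_mul_mul (a b : Octonion) : star a * (a * b) = (‖a‖ ^ 2) • b := by
  rw [norm_sq_eq, Quaternion.normSq_def', Quaternion.normSq_def']
  ext <;> simp <;> ring

theorem norm_sq_ne {a : Octonion} (ha : a ≠ 0) : ‖a‖ ^ 2 ≠ 0 :=
  pow_ne_zero 2 (norm_ne_zero_iff.mpr ha)

theorem mul_mul_inv {a : Octonion} (ha : a ≠ 0) (b : Octonion) : (b * a) * a⁻¹ = b := by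
  rw [inv_def, mul_smul', mul_mul_star, smul_smul, inv_mul_cancel₀ (norm_sq_ne ha), one_smul]

theorem mul_inv_mul {a : Octonion} (ha : a ≠ 0) (b : Octonion) : (b * a⁻¹) * a = b := by
  rw [inv_def, mul_smul', smul_mul', mul_star_mul, smul_smul,
    inv_mul_cancel₀ (norm_sq_ne ha), one_smul]

theorem inv_mul_mul {a : Octonion} (ha : a ≠ 0) (b : Octonion) : a⁻¹ * (a * b) = b := by
  rw [inv_def, smul_mul', star_mul_mul, smul_smul, inv_mul_cancel₀ (norm_sq_ne ha), one_smul]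

theorem one_ne_zero' : (1 : Octonion) ≠ 0 := by
  intro h
  have := congrArg fst h
  simp at this

theorem mul_inv_self {a : Octonion} (ha : a ≠ 0) : a * a⁻¹ = 1 := by
  simpa [one_mul'] using mul_mul_inv ha 1

theorem inv_ne_zero' {a : Octonion} (ha : a ≠ 0) : a⁻¹ ≠ 0 := by
  rw [inv_def]
  refine smul_ne_zero (inv_ne_zero (norm_sq_ne ha)) fun h => ha ?_
  have h1 := congrArg fst h
  have h2 := congrArg snd h
  ext1
  · simpa using h1
  · simpa using h2

theorem inv_one' : (1 : Octonion)⁻¹ = 1 := by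
  simpa [one_mul'] using mul_inv_self one_ne_zero'

theorem eq_inv_of_mul_eq_one {a b : Octonion} (hb : b ≠ 0) (h : a * b = 1) : a = b⁻¹ := by
  rw [← mul_mul_inv hb a, h, one_mul']

theorem mul_ne_zero' {a b : Octonion} (ha : a ≠ 0) (hb : b ≠ 0) : a * b ≠ 0 := by
  intro h
  apply ha
  rw [← mul_mul_inv hb a, h, zero_mul']

theorem assoc_of_mul_eq_one {z μ lam : Octonion} (hμ : μ ≠ 0) (hl : lam ≠ 0)
    (h : (z * μ) * lam = 1) : z * (μ * lam) = 1 := by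
  have h1 : z * μ = lam⁻¹ := eq_inv_of_mul_eq_one hl h
  have h2 : z = lam⁻¹ * μ⁻¹ := by rw [← h1, mul_mul_inv hμ]
  rw [h2]
  have key : (star lam * star μ) * (μ * lam) = (‖lam‖ ^ 2 * ‖μ‖ ^ 2) • (1 : Octonion) := by
    rw [norm_sq_eq, norm_sq_eq, Quaternion.normSq_def', Quaternion.normSq_def',
      Quaternion.normSq_def', Quaternion.normSq_def']
    ext <;> simp <;> ring
  rw [inv_def, inv_def, smul_mul', mul_smul', smul_mul', smul_mul', key, smul_smul, smul_smul]
  have := norm_sq_ne hμ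
  have := norm_sq_ne hl
  have e : (‖lam‖ ^ 2)⁻¹ * ((‖μ‖ ^ 2)⁻¹ * (‖lam‖ ^ 2 * ‖μ‖ ^ 2)) = 1 := by field_simp
  simp [mul_assoc, e]

theorem contDiff_fst {n : ℕ∞ω} : ContDiff ℝ n fst :=
  _root_.contDiff_fst.comp (WithLp.contDiff_ofLp (𝕜 := ℝ) (p := 2) (E := ℍ[ℝ]) (F := ℍ[ℝ]))

theorem contDiff_snd {n : ℕ∞ω} : ContDiff ℝ n snd :=
  _root_.contDiff_snd.comp (WithLp.contDiff_ofLp (𝕜 := ℝ) (p := 2) (E := ℍ[ℝ]) (F := ℍ[ℝ]))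

theorem contDiff_mk {n : ℕ∞ω} : ContDiff ℝ n (fun p : ℍ[ℝ] × ℍ[ℝ] => mk p.1 p.2) :=
  WithLp.contDiff_toLp (𝕜 := ℝ) (p := 2) (E := ℍ[ℝ]) (F := ℍ[ℝ])

theorem contDiff_quatStar {n : ℕ∞ω} : ContDiff ℝ n (star : ℍ[ℝ] → ℍ[ℝ]) :=
  (LinearMap.toContinuousLinearMap
    ({ toFun := star, map_add' := fun a b => star_add a b,
       map_smul' := fun c a => by ext <;> simp } : ℍ[ℝ] →ₗ[ℝ] ℍ[ℝ])).contDiff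

theorem contDiff_mul {n : ℕ∞ω} : ContDiff ℝ n (fun p : Octonion × Octonion => p.1 * p.2) := by
  have h1 : ContDiff ℝ n fun p : Octonion × Octonion => p.1.fst :=
    contDiff_fst.comp _root_.contDiff_fst
  have h2 : ContDiff ℝ n fun p : Octonion × Octonion => p.1.snd :=
    contDiff_snd.comp _root_.contDiff_fst
  have h3 : ContDiff ℝ n fun p : Octonion × Octonion => p.2.fst :=
    contDiff_fst.comp _root_.contDiff_snd
  have h4 : ContDiff ℝ n fun p : Octonion × Octonion => p.2.snd :=
    contDiff_snd.comp _root_.contDiff_snd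
  exact contDiff_mk.comp (((h1.mul h3).sub ((contDiff_quatStar.comp h4).mul h2)).prodMk
    ((h4.mul h1).add (h2.mul (contDiff_quatStar.comp h3))))

theorem contDiff_star {n : ℕ∞ω} : ContDiff ℝ n (star : Octonion → Octonion) :=
  contDiff_mk.comp ((contDiff_quatStar.comp contDiff_fst).prodMk contDiff_snd.neg)

theorem contDiffOn_inv {n : ℕ∞ω} : ContDiffOn ℝ n (fun a : Octonion => a⁻¹) {a | a ≠ 0} := by
  have h : ContDiffOn ℝ n (fun a : Octonion => (‖a‖ ^ 2)⁻¹) {a | a ≠ 0} :=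
    (contDiff_norm_sq ℝ).contDiffOn.inv fun a ha => norm_sq_ne ha
  exact h.smul contDiff_star.contDiffOn

end Octonion

/-! ### The octonionic projective plane as a set and a topological space -/

namespace OP2

open Octonion

/-- The set `𝒰 = U₁ ∪ U₂ ∪ U₃ ⊆ 𝕆³` of triples with at least one entry equal to `1`. -/
def ReducedTriples : Set (Fin 3 → Octonion) := {x | ∃ i, x i = 1}

/-- `x ∼ y` when `x = y λ` entrywise for some nonzero octonion `λ`. -/
def Rel (x y : ReducedTriples) : Prop :=
  ∃ lam : Octonion, lam ≠ 0 ∧ ∀ k, x.1 k = y.1 k * lam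

theorem rel_equivalence : Equivalence Rel where
  refl x := ⟨1, one_ne_zero', fun k => (mul_one' _).symm⟩
  symm := by
    rintro x y ⟨l, hl, h⟩
    exact ⟨l⁻¹, inv_ne_zero' hl, fun k => by rw [h k, mul_mul_inv hl]⟩
  trans := by
    rintro ⟨x, l, hx⟩ ⟨y, k, hy⟩ ⟨z, i, hz⟩ ⟨a, ha, hxy⟩ ⟨m, hm, hyz⟩
    simp only at hxy hyz
    refine ⟨m * a, mul_ne_zero' hm ha, fun j => ?_⟩
    simp only
    rw [hxy, hyz]
    have hk : z k * m = 1 := by rw [← hyz, hy]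
    have hl : (z l * m) * a = 1 := by rw [← hyz, ← hxy, hx]
    by_cases hik : i = k
    · subst hik
      rw [hz, one_mul'] at hk
      rw [hk, mul_one', one_mul']
    by_cases hkl : k = l
    · subst hkl
      rw [hk, one_mul'] at hl
      rw [hl, mul_one', mul_one']
    by_cases hil : i = l
    · subst hil
      rw [hz, one_mul'] at hl
      have : a = m⁻¹ := by rw [← inv_mul_mul hm a, hl, mul_one']
      rw [hl, mul_one', this, mul_mul_inv hm]
    have hj : j = i ∨ j = k ∨ j = l := by omega
    rcases hj with rfl | rfl | rfl
    · rw [hz, one_mul', one_mul']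
    · rw [hk, one_mul', eq_inv_of_mul_eq_one hm hk, inv_mul_mul hm]
    · rw [hl, assoc_of_mul_eq_one hm ha hl]

instance setoid : Setoid ReducedTriples := ⟨Rel, rel_equivalence⟩

end OP2

/-- The octonionic projective plane `𝕆P² = 𝒰 / ∼`, with the quotient topology. -/
def OP2 : Type := Quotient OP2.setoid

namespace OP2

open Octonion

instance : TopologicalSpace OP2 := inferInstanceAs (TopologicalSpace (Quotient OP2.setoid))

/-- The class of a reduced triple. -/
def proj (x : ReducedTriples) : OP2 := Quotient.mk OP2.setoid x

/-- `ofCoords i (u, v)` is `[1, u, v]`, `[u, 1, v]`, `[u, v, 1]` for `i = 0, 1, 2`. -/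
def ofCoords (i : Fin 3) (z : Octonion × Octonion) : OP2 :=
  proj ⟨i.insertNth (1 : Octonion) ![z.1, z.2], i, by simp⟩

/-- Affine coordinates of a triple: the two entries other than the `i`-th, in order,
multiplied on the right by the inverse of the `i`-th. -/
def tripleCoords (i : Fin 3) (x : Fin 3 → Octonion) : Octonion × Octonion :=
  (x (i.succAbove 0) * (x i)⁻¹, x (i.succAbove 1) * (x i)⁻¹)

theorem proj_ofCoords_tripleCoords (i : Fin 3) (x : ReducedTriples) (h : x.1 i ≠ 0) :
    ofCoords i (tripleCoords i x.1) = proj x := by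
  refine Quotient.sound ⟨(x.1 i)⁻¹, inv_ne_zero' h, fun k => ?_⟩
  rcases Fin.eq_self_or_eq_succAbove i k with rfl | ⟨j, rfl⟩
  · simp [mul_inv_self h]
  · fin_cases j <;> simp [tripleCoords]

theorem ofCoords_injective (i : Fin 3) : Function.Injective (ofCoords i) := by
  rintro ⟨u, v⟩ ⟨u', v'⟩ h
  obtain ⟨l, hl, h⟩ := Quotient.exact h
  have h0 := h i
  have h1 := h (i.succAbove 0)
  have h2 := h (i.succAbove 1)
  simp only [Fin.insertNth_apply_same, Fin.insertNth_apply_succAbove, one_mul'] at h0 h1 h2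
  subst h0
  simp only [mul_one', Matrix.cons_val_zero, Matrix.cons_val_one] at h1 h2
  rw [h1, h2]

theorem tripleCoords_congr (i : Fin 3) (x y : ReducedTriples) (h : x ≈ y) :
    tripleCoords i x.1 = tripleCoords i y.1 := by
  obtain ⟨l, hl, hxy⟩ := id h
  by_cases hy : y.1 i = 0
  · have hx : x.1 i = 0 := by rw [hxy, hy, zero_mul']
    simp [tripleCoords, hx, hy, inv_def, mul_zero']
  · have hx : x.1 i ≠ 0 := by rw [hxy]; exact mul_ne_zero' hy hl
    apply ofCoords_injective i
    rw [proj_ofCoords_tripleCoords i x hx, proj_ofCoords_tripleCoords i y hy]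
    exact Quotient.sound h

/-- The affine coordinates on `𝕆P²`: `[1, u, v] ↦ (u, v)`, `[u, 1, v] ↦ (u, v)`,
`[u, v, 1] ↦ (u, v)` for `i = 0, 1, 2` (with an irrelevant value off `Uᵢ / ∼`). -/
def coords (i : Fin 3) (p : OP2) : Octonion × Octonion :=
  Quotient.lift (fun x : ReducedTriples => tripleCoords i x.1) (tripleCoords_congr i) p

theorem coords_ofCoords (i : Fin 3) (z : Octonion × Octonion) :
    coords i (ofCoords i z) = z := by
  change tripleCoords i (i.insertNth (1 : Octonion) ![z.1, z.2]) = z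
  simp [tripleCoords, inv_one', mul_one']

theorem proj_mem_range {i : Fin 3} {x : ReducedTriples} :
    proj x ∈ Set.range (ofCoords i) ↔ x.1 i ≠ 0 := by
  constructor
  · rintro ⟨z, hz⟩
    obtain ⟨l, hl, h⟩ := Quotient.exact hz
    have h0 := h i
    simp only [Fin.insertNth_apply_same] at h0
    intro hx
    rw [hx, zero_mul'] at h0
    exact one_ne_zero' h0
  · intro h
    exact ⟨_, proj_ofCoords_tripleCoords i x h⟩

theorem isQuotientMap_proj : Topology.IsQuotientMap proj := isQuotientMap_quotient_mk'

theorem isOpen_range_ofCoords (i : Fin 3) : IsOpen (Set.range (ofCoords i)) := by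
  rw [← isQuotientMap_proj.isOpen_preimage]
  have : proj ⁻¹' Set.range (ofCoords i) = {x | x.1 i ≠ 0} := by
    ext x; exact proj_mem_range
  rw [this]
  exact isOpen_ne_fun ((continuous_apply i).comp continuous_subtype_val) continuous_const

theorem contDiffOn_tripleCoords (i : Fin 3) :
    ContDiffOn ℝ ω (tripleCoords i) {x | x i ≠ 0} := by
  have hinv : ContDiffOn ℝ ω (fun x : Fin 3 → Octonion => (x i)⁻¹) {x | x i ≠ 0} :=
    contDiffOn_inv.comp (contDiff_apply ℝ Octonion i).contDiffOn fun x hx => hx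
  have hmul (k : Fin 3) :
      ContDiffOn ℝ ω (fun x : Fin 3 → Octonion => x k * (x i)⁻¹) {x | x i ≠ 0} :=
    ContDiff.comp_contDiffOn (g := fun p : Octonion × Octonion => p.1 * p.2)
      (f := fun x : Fin 3 → Octonion => (x k, (x i)⁻¹)) contDiff_mul
      ((contDiff_apply ℝ Octonion k).contDiffOn.prodMk hinv)
  exact (hmul _).prodMk (hmul _)

theorem contDiff_insertNth (i : Fin 3) :
    ContDiff ℝ ω fun z : Octonion × Octonion =>
      (i.insertNth (1 : Octonion) ![z.1, z.2] : Fin 3 → Octonion) := by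
  rw [contDiff_pi]
  intro k
  rcases Fin.eq_self_or_eq_succAbove i k with rfl | ⟨j, rfl⟩
  · simpa using contDiff_const
  · fin_cases j
    · simpa using _root_.contDiff_fst
    · simpa using _root_.contDiff_snd

/-- The chart `φᵢ : Uᵢ / ∼ → 𝕆²`. -/
def chart (i : Fin 3) : OpenPartialHomeomorph OP2 (Octonion × Octonion) where
  toFun := coords i
  invFun := ofCoords i
  source := Set.range (ofCoords i)
  target := Set.univ
  map_source' _ _ := Set.mem_univ _
  map_target' z _ := ⟨z, rfl⟩
  left_inv' := by
    rintro _ ⟨z, rfl⟩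
    rw [coords_ofCoords]
  right_inv' z _ := coords_ofCoords i z
  open_source := isOpen_range_ofCoords i
  open_target := isOpen_univ
  continuousOn_toFun := by
    rw [isQuotientMap_proj.continuousOn_isOpen_iff (isOpen_range_ofCoords i)]
    exact (contDiffOn_tripleCoords i).continuousOn.comp continuous_subtype_val.continuousOn
      fun x hx => proj_mem_range.mp hx
  continuousOn_invFun := by
    refine Continuous.continuousOn ?_
    exact isQuotientMap_proj.continuous.comp
      ((contDiff_insertNth i).continuous.subtype_mk fun z => ⟨i, by simp⟩)

theorem exists_mem_source (p : OP2) : ∃ i, p ∈ (chart i).source := by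
  obtain ⟨⟨x, i, hi⟩, rfl⟩ := Quotient.exists_rep p
  exact ⟨i, proj_mem_range.mpr fun h => one_ne_zero' (hi.symm.trans h)⟩

/-- The atlas `{φ₁, φ₂, φ₃}`. -/
instance : ChartedSpace (Octonion × Octonion) OP2 where
  atlas := Set.range chart
  chartAt p := chart (exists_mem_source p).choose
  mem_chart_source p := (exists_mem_source p).choose_spec
  chart_mem_atlas _ := ⟨_, rfl⟩

instance : IsManifold 𝓘(ℝ, Octonion × Octonion) ω OP2 := by
  apply isManifold_of_contDiffOn
  rintro _ _ ⟨i, rfl⟩ ⟨j, rfl⟩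
  have h := (contDiffOn_tripleCoords j).comp (contDiff_insertNth i).contDiffOn
    (s := {z : Octonion × Octonion | (i.insertNth (1 : Octonion) ![z.1, z.2] : Fin 3 → Octonion) j ≠ 0}) fun z hz => hz
  refine h.mono ?_
  rintro z ⟨hz, -⟩
  exact proj_mem_range.mp hz.2

/-! ### The metric, isometries, reflections and rotations -/

/-- The quadratic form `ds²` at the point with coordinates `z = (u, v)`, evaluated on the
tangent vector `d = (du, dv)`. -/
def ds2 (z d : Octonion × Octonion) : ℝ :=
  (‖d.1‖ ^ 2 * (1 + ‖z.2‖ ^ 2) + ‖d.2‖ ^ 2 * (1 + ‖z.1‖ ^ 2)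
      - 2 * re ((z.1 * star z.2) * (d.2 * star d.1)))
    / (1 + ‖z.1‖ ^ 2 + ‖z.2‖ ^ 2) ^ 2

/-- Smooth Riemannian metrics on `𝕆P²`. -/
abbrev SmoothMetric : Type :=
  Bundle.ContMDiffRiemannianMetric 𝓘(ℝ, Octonion × Octonion) ∞ (Octonion × Octonion)
    (fun p : OP2 => TangentSpace 𝓘(ℝ, Octonion × Octonion) p)

/-- `g` is given by the expression `ds²` in each of the three charts. -/
def IsOctonionicMetric (g : SmoothMetric) : Prop :=
  ∀ (i : Fin 3) (p : OP2), p ∈ (chart i).source →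
    ∀ w : TangentSpace 𝓘(ℝ, Octonion × Octonion) p,
      g.inner p w w = ds2 (chart i p)
        (mfderiv 𝓘(ℝ, Octonion × Octonion) 𝓘(ℝ, Octonion × Octonion) (chart i) p w)

/-- `f` is a (global) isometry of `(𝕆P², g)`: a diffeomorphism preserving `g`. -/
def IsRiemannianIsometry (g : SmoothMetric) (f : OP2 → OP2) : Prop :=
  ∃ Φ : OP2 ≃ₘ^∞⟮𝓘(ℝ, Octonion × Octonion), 𝓘(ℝ, Octonion × Octonion)⟯ OP2, ⇑Φ = f ∧
    ∀ (p : OP2) (w w' : TangentSpace 𝓘(ℝ, Octonion × Octonion) p),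
      g.inner (Φ p)
          (mfderiv 𝓘(ℝ, Octonion × Octonion) 𝓘(ℝ, Octonion × Octonion) Φ p w)
          (mfderiv 𝓘(ℝ, Octonion × Octonion) 𝓘(ℝ, Octonion × Octonion) Φ p w')
        = g.inner p w w'

/-- The isometries of `(𝕆P², g)` act transitively. -/
def IsHomogeneous (g : SmoothMetric) : Prop :=
  ∀ p q : OP2, ∃ f : OP2 → OP2, IsRiemannianIsometry g f ∧ f p = q

/-- `(u, v) ↦ (r u + λ v, λ̄ u - r v)`. -/
def reflectionCoords (r : ℝ) (lam : Octonion) (z : Octonion × Octonion) :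
    Octonion × Octonion :=
  (r • z.1 + lam * z.2, star lam * z.1 - r • z.2)

/-- `f` is an analytic extension to `𝕆P²` of the reflection `R_{r,λ}` of the chart domain
`Uᵢ / ∼`. -/
def IsGlobalReflection (i : Fin 3) (r : ℝ) (lam : Octonion) (f : OP2 → OP2) : Prop :=
  ContMDiff 𝓘(ℝ, Octonion × Octonion) 𝓘(ℝ, Octonion × Octonion) ω f ∧
    ∀ z : Octonion × Octonion, f (ofCoords i z) = ofCoords i (reflectionCoords r lam z)

/-- `f` is the rotation `I_t`, the composition of the global extensions of the reflections
`R_{1,0}` and `R_{cos t, sin t}` of `U₃ / ∼`. -/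
def IsRotation (t : ℝ) (f : OP2 → OP2) : Prop :=
  ∃ f₁ f₂ : OP2 → OP2, IsGlobalReflection 2 1 0 f₁ ∧
    IsGlobalReflection 2 (Real.cos t) (Real.sin t • (1 : Octonion)) f₂ ∧ f = f₁ ∘ f₂

/-- Finite compositions of globally extended reflections `R_{r,λ}` of `U₁ / ∼`
(with `r² + |λ|² = 1`) and rotations `I_t`. -/
inductive IsComposite : (OP2 → OP2) → Prop
  | refl : IsComposite id
  | reflection_comp (r : ℝ) (lam : Octonion) (ρ f : OP2 → OP2) (h : r ^ 2 + ‖lam‖ ^ 2 = 1)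
      (hρ : IsGlobalReflection 0 r lam ρ) (hf : IsComposite f) : IsComposite (ρ ∘ f)
  | rotation_comp (t : ℝ) (ρ f : OP2 → OP2)
      (hρ : IsRotation t ρ) (hf : IsComposite f) : IsComposite (ρ ∘ f)

end OP2

end

noncomputable section

set_option maxSynthPendingDepth 3

namespace Octonion

/-! ### Algebraic identities for octonions -/

/-! Everything is transported to the real vector space of 3 × 3 octonionic matrices by `emb`, [x] ↦
x x* / |x|². Octonions do not associate, but each reduced triple has an entry 1, so the products
that occur reduce to products of two octonions and their conjugates, for which the alternative laws
suffice. Hence `emb` is well defined. Its image consists of the Hermitian matrices of trace one with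
P_ac P_cb = P_cc P_ab (`isRankOneProjection_emb`, `IsRankOneProjection.emb_eq`). Affine coordinates
are quotients of matrix entries, so `emb` is injective, and a map that becomes linear under `emb` is
analytic (`contMDiff_of_emb_comp`).

Half the Hilbert-Schmidt form pulls back to ds² in every chart (`pairing_fderiv_emb`). The three
local expressions are therefore restrictions of one global form, positive definite by `ds2_ge`;
polarisation makes it the only candidate.

A reflection is formally P ↦ R P R*. The identity `moufang_reflection` turns this into a genuine
linear map that agrees with R_{r,λ} on the i-th chart (`reflectionMatrix_outer`) and preserves the
Hilbert-Schmidt norm (`sqNorm_reflectionMatrix`). The chart is dense and the rank one conditions are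
closed, so the map preserves the image of `emb`: this gives the analytic extension and shows that it
is an isometry. Density in a Hausdorff space gives uniqueness and involutivity.

For transitivity, rotations carry [1,0,0] to every [1,x,0] with x real, and reflections of the first
chart act transitively on the spheres |u|² + |v|² = x². This exhausts U₁; points with first entry 0
are reached by a quarter turn, or by a swap of the last two entries. Homogeneity follows by
composing with inverses. -/

instance : FiniteDimensional ℝ Octonion :=
  inferInstanceAs (FiniteDimensional ℝ (WithLp 2 (ℍ[ℝ] × ℍ[ℝ])))

scoped instance instNonUnitalNonAssocRing : NonUnitalNonAssocRing Octonion where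
  left_distrib a b c := by ext <;> simp <;> ring
  right_distrib a b c := by ext <;> simp <;> ring
  zero_mul := zero_mul'
  mul_zero := mul_zero'

instance : IsScalarTower ℝ Octonion Octonion := ⟨fun c a b => smul_mul' c a b⟩

instance : SMulCommClass ℝ Octonion Octonion := ⟨fun c a b => (mul_smul' c a b).symm⟩

instance : StarRing Octonion where
  star_involutive a := by ext1 <;> simp
  star_mul a b := by ext <;> simp
  star_add a b := by ext <;> simp [add_comm]

instance : StarModule ℝ Octonion := ⟨fun c a => by ext <;> simp⟩

@[simp] theorem star_one' : star (1 : Octonion) = 1 := by ext <;> simp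

@[simp] theorem re_add (a b : Octonion) : re (a + b) = re a + re b := rfl
@[simp] theorem re_smul (c : ℝ) (a : Octonion) : re (c • a) = c * re a := rfl
@[simp] theorem re_one : re (1 : Octonion) = 1 := rfl

theorem inner_eq_re (a b : Octonion) : inner ℝ a b = re (a * star b) := by
  have h : inner ℝ a b = inner ℝ a.fst b.fst + inner ℝ a.snd b.snd :=
    WithLp.prod_inner_apply (𝕜 := ℝ) (E := ℍ[ℝ]) (F := ℍ[ℝ]) a b
  rw [h, Quaternion.inner_def, Quaternion.inner_def]
  simp [re]
  ring

theorem norm_star' (a : Octonion) : ‖star a‖ = ‖a‖ := by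
  rw [← sq_eq_sq₀ (norm_nonneg _) (norm_nonneg _), norm_sq_eq, norm_sq_eq]
  simp

@[simp] theorem norm_one' : ‖(1 : Octonion)‖ = 1 := by
  rw [← sq_eq_sq₀ (norm_nonneg _) zero_le_one, norm_sq_eq]
  simp

theorem norm_mul' (a b : Octonion) : ‖a * b‖ = ‖a‖ * ‖b‖ := by
  rw [← sq_eq_sq₀ (norm_nonneg _) (by positivity), mul_pow, norm_sq_eq, norm_sq_eq, norm_sq_eq]
  simp only [Quaternion.normSq_def']
  simp
  ring

theorem mul_star_self' (a : Octonion) : a * star a = (‖a‖ ^ 2) • (1 : Octonion) := by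
  have := mul_mul_star a 1
  rwa [one_mul'] at this

theorem star_mul_self' (a : Octonion) : star a * a = (‖a‖ ^ 2) • (1 : Octonion) := by
  have := mul_star_mul a 1
  rwa [one_mul'] at this

theorem mul_star_mul_left (a b : Octonion) : a * (star a * b) = (‖a‖ ^ 2) • b := by
  have := star_mul_mul (star a) b
  rwa [star_star, norm_star'] at this

theorem inner_star_star (a b : Octonion) : inner ℝ (star a) (star b) = inner ℝ a b := by
  rw [inner_eq_re, inner_eq_re]
  simp [re]

theorem inner_one_left (a : Octonion) : inner ℝ 1 a = re a := by
  rw [inner_eq_re]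
  simp [re]

/-- Right multiplication by `v` is adjoint to right multiplication by `v̄`. -/
theorem inner_mul_right_eq (u lam v : Octonion) :
    inner ℝ u (lam * v) = inner ℝ (u * star v) lam := by
  rw [inner_eq_re, inner_eq_re]
  simp [re]
  ring

/-- Left multiplication by `a` is adjoint to left multiplication by `ā`. -/
theorem inner_mul_left_eq (u lam v : Octonion) :
    inner ℝ u (lam * v) = inner ℝ (star lam * u) v := by
  rw [inner_eq_re, inner_eq_re]
  simp [re]
  ring

/-- Polarised composition law. -/
theorem inner_mul_mul_add (a b c d : Octonion) :
    inner ℝ (a * c) (b * d) + inner ℝ (a * d) (b * c) = 2 * (inner ℝ a b * inner ℝ c d) := by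
  simp only [inner_eq_re]
  simp [re]
  ring

theorem mul_star_add_mul_star (a b : Octonion) :
    a * star b + b * star a = (2 * inner ℝ a b) • (1 : Octonion) := by
  rw [inner_eq_re]
  ext <;> simp [re] <;> ring

/-- `(λ v)(ū λ) = λ (v ū) λ = 2 ⟨λ, u v̄⟩ λ - |λ|² u v̄`. -/
theorem moufang_reflection (lam u v : Octonion) :
    (lam * v) * (star u * lam) =
      (2 * inner ℝ lam (u * star v)) • lam - (‖lam‖ ^ 2) • (u * star v) := by
  refine ext_inner_right ℝ fun x => ?_
  have h₁ : inner ℝ ((lam * v) * (star u * lam)) x = inner ℝ (lam * v) (x * (star lam * u)) := by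
    rw [inner_mul_right_eq, star_mul, star_star, real_inner_comm]
  -- Tested against x, the product becomes ⟨λv, x(λ̄u)⟩. The polarised composition law trades it for
  -- 2⟨λ,x⟩⟨v,λ̄u⟩ minus ⟨λ(λ̄u), xv⟩ = |λ|²⟨u v̄, x⟩, so no reassociation is needed.
  have h₂ := inner_mul_mul_add lam x v (star lam * u)
  have h₃ : inner ℝ v (star lam * u) = inner ℝ lam (u * star v) := by
    rw [real_inner_comm, ← inner_mul_left_eq, inner_mul_right_eq, real_inner_comm]
  rw [mul_star_mul_left, real_inner_smul_left, inner_mul_right_eq u x v, h₃] at h₂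
  rw [h₁, inner_sub_left, real_inner_smul_left, real_inner_smul_left]
  linarith

theorem eq_re_smul_one {a : Octonion} (h : star a = a) : a = re a • (1 : Octonion) := by
  have h1 := congrArg fst h
  have h2 := congrArg snd h
  simp only [fst_star, snd_star] at h1 h2
  ext1
  · have := Quaternion.star_eq_self.mp h1
    rw [this]
    ext <;> simp [re]
  · have : a.snd = 0 := by
      have h : (2 : ℝ) • a.snd = 0 := by rw [two_smul, add_eq_zero_iff_eq_neg]; exact h2.symm
      exact (smul_eq_zero.mp h).resolve_left two_ne_zero
    simp [this]

theorem contDiff_re {n : ℕ∞ω} : ContDiff ℝ n re := by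
  have : re = fun a => inner ℝ (1 : Octonion) a := by ext a; rw [inner_one_left]
  rw [this]
  exact contDiff_const.inner ℝ contDiff_id

end Octonion

namespace OP2

open Octonion

/-! ### The embedding of `𝕆P²` into `3 × 3` octonionic matrices -/

/-- The matrix `x x*`. -/
def outer (x : Fin 3 → Octonion) : Fin 3 → Fin 3 → Octonion := fun a b => x a * star (x b)

/-- The matrix `x x* / |x|²`. -/
def projector (x : Fin 3 → Octonion) : Fin 3 → Fin 3 → Octonion :=
  (∑ k, ‖x k‖ ^ 2)⁻¹ • outer x

theorem projector_apply (x : Fin 3 → Octonion) (a b : Fin 3) :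
    projector x a b = (∑ k, ‖x k‖ ^ 2)⁻¹ • (x a * star (x b)) := rfl

theorem sum_norm_sq_pos (x : ReducedTriples) : 0 < ∑ k, ‖x.1 k‖ ^ 2 := by
  obtain ⟨x, i, hi⟩ := x
  refine Finset.sum_pos' (fun k _ => by positivity) ⟨i, Finset.mem_univ _, ?_⟩
  simp [hi]

/-- Associativity is avoided because y_m = 1 and x_n = 1 for some m, n. The first makes x_m = λ and
the second makes y_n a real multiple of λ̄, so if a or b is m or n, only λ, one further entry and
their conjugates are multiplied. -/
theorem outer_mul_right {x y : ReducedTriples} {lam : Octonion}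
    (h : ∀ k, x.1 k = y.1 k * lam) (a b : Fin 3) :
    x.1 a * star (x.1 b) = (‖lam‖ ^ 2) • (y.1 a * star (y.1 b)) := by
  obtain ⟨x, n, hn⟩ := x
  obtain ⟨y, m, hm⟩ := y
  simp only at h ⊢
  have hn' : y n * lam = 1 := by rw [← h, hn]
  have hlam : lam ≠ 0 := by
    rintro rfl
    rw [mul_zero'] at hn'
    exact one_ne_zero' hn'.symm
  have hy : (‖lam‖ ^ 2) • y n = star lam := by
    rw [← mul_mul_star lam (y n), hn', one_mul']
  rw [h a, h b, star_mul]
  by_cases ham : a = m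
  · rw [ham, hm, one_mul', one_mul', mul_star_mul_left]
  by_cases hbm : b = m
  · rw [hbm, hm, star_one', mul_one', mul_one', mul_mul_star]
  by_cases han : a = n
  · rw [han, hn', one_mul', ← smul_mul_assoc, hy]
  by_cases hbn : b = n
  · have hy' := congrArg star hy
    rw [star_smul, star_star, star_trivial] at hy'
    rw [hbn, ← star_mul, hn', star_one', mul_one', ← mul_smul_comm, hy']
  -- If m = n then λ = 1. Otherwise a and b both avoid two distinct indices, so a = b and both sides
  -- are real.
  by_cases hmn : m = n
  · rw [← hmn, hm, one_mul'] at hn'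
    simp [hn', mul_one', one_mul']
  have hab : a = b := by omega
  rw [hab, ← star_mul, mul_star_self', mul_star_self', norm_mul', smul_smul]
  congr 1
  ring

theorem projector_congr (x y : ReducedTriples) (h : x ≈ y) : projector x.1 = projector y.1 := by
  obtain ⟨lam, hlam, h⟩ := id h
  have hs : ∑ k, ‖x.1 k‖ ^ 2 = ‖lam‖ ^ 2 * ∑ k, ‖y.1 k‖ ^ 2 := by
    rw [Finset.mul_sum]
    refine Finset.sum_congr rfl fun k _ => ?_
    rw [h k, norm_mul']
    ring
  funext a b
  rw [projector_apply, projector_apply, outer_mul_right h, hs, smul_smul]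
  congr 1
  have := norm_sq_ne hlam
  have := (sum_norm_sq_pos y).ne'
  field_simp

/-- The embedding `[x] ↦ x x* / |x|²` of `𝕆P²` into octonionic matrices. -/
def emb (p : OP2) : Fin 3 → Fin 3 → Octonion :=
  Quotient.lift (fun x : ReducedTriples => projector x.1) projector_congr p

/-- The triple `(1, u, v)`, `(u, 1, v)` or `(u, v, 1)`. -/
abbrev affine (i : Fin 3) (z : Octonion × Octonion) : Fin 3 → Octonion :=
  i.insertNth (1 : Octonion) ![z.1, z.2]

/-- `1 + |u|² + |v|²`. -/
def denom (z : Octonion × Octonion) : ℝ := 1 + ‖z.1‖ ^ 2 + ‖z.2‖ ^ 2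

theorem denom_pos (z : Octonion × Octonion) : 0 < denom z := by
  unfold denom
  positivity

theorem emb_ofCoords (i : Fin 3) (z : Octonion × Octonion) :
    emb (ofCoords i z) = (denom z)⁻¹ • outer (affine i z) := by
  change projector (affine i z) = _
  rw [projector, Fin.sum_univ_succAbove _ i]
  simp [denom, add_assoc]

/-- The affine coordinates read off a matrix. -/
def matrixCoords (i : Fin 3) (P : Fin 3 → Fin 3 → Octonion) : Octonion × Octonion :=
  ((re (P i i))⁻¹ • P (i.succAbove 0) i, (re (P i i))⁻¹ • P (i.succAbove 1) i)

/-- The i-th column divided by the i-th diagonal entry is x_a x̄_i / |x_i|² = x_a x_i⁻¹. No chart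
hypothesis is needed: if x_i = 0, both sides are 0 by the convention 0⁻¹ = 0. -/
theorem coords_eq_matrixCoords (i : Fin 3) (p : OP2) : coords i p = matrixCoords i (emb p) := by
  obtain ⟨x, rfl⟩ := Quotient.exists_rep p
  change tripleCoords i x.1 = matrixCoords i (projector x.1)
  have h := (sum_norm_sq_pos x).ne'
  have key (a : Octonion) : a * (x.1 i)⁻¹ = (re (projector x.1 i i))⁻¹ •
      ((∑ k, ‖x.1 k‖ ^ 2)⁻¹ • (a * star (x.1 i))) := by
    rw [inv_def, mul_smul_comm, projector_apply, mul_star_self', smul_smul]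
    congr 1
    simp
    field_simp
  exact Prod.ext (key _) (key _)

theorem mem_source_iff (i : Fin 3) (p : OP2) : p ∈ (chart i).source ↔ re (emb p i i) ≠ 0 := by
  obtain ⟨x, rfl⟩ := Quotient.exists_rep p
  change proj x ∈ Set.range (ofCoords i) ↔ re (projector x.1 i i) ≠ 0
  rw [proj_mem_range, projector_apply, mul_star_self']
  have h := (sum_norm_sq_pos x).ne'
  simp [h]

theorem ofCoords_coords {i : Fin 3} {p : OP2} (h : p ∈ (chart i).source) :
    ofCoords i (coords i p) = p := (chart i).left_inv h

/-- The matrix tells which charts contain the point and what its coordinates there are. -/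
theorem emb_injective : Function.Injective emb := by
  intro p q h
  obtain ⟨i, hi⟩ := exists_mem_source p
  have hq : q ∈ (chart i).source := by rwa [mem_source_iff, ← h, ← mem_source_iff]
  rw [← ofCoords_coords hi, ← ofCoords_coords hq, coords_eq_matrixCoords, coords_eq_matrixCoords, h]

/-- The rank one projections among octonionic matrices. -/
structure IsRankOneProjection (P : Fin 3 → Fin 3 → Octonion) : Prop where
  star_apply : ∀ a b, star (P a b) = P b a
  trace_eq_one : ∑ a, re (P a a) = 1
  mul_eq : ∀ a b c, P a c * P c b = re (P c c) • P a b

theorem isRankOneProjection_emb (p : OP2) : IsRankOneProjection (emb p) := by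
  obtain ⟨x, rfl⟩ := Quotient.exists_rep p
  change IsRankOneProjection (projector x.1)
  have h := (sum_norm_sq_pos x).ne'
  refine ⟨fun a b => ?_, ?_, fun a b c => ?_⟩
  · simp [projector_apply]
  · simp only [projector_apply, mul_star_self', re_smul, re_one, mul_one, ← Finset.mul_sum]
    exact inv_mul_cancel₀ h
  · simp only [projector_apply, smul_mul_assoc, mul_smul_comm, smul_smul, re_smul]
    -- If the index m of the entry 1 is among a, b, c, at most two other entries are involved. If
    -- not, a, b, c lie in a set of two indices, so two of them coincide.
    have key : (x.1 a * star (x.1 c)) * (x.1 c * star (x.1 b)) =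
        (‖x.1 c‖ ^ 2) • (x.1 a * star (x.1 b)) := by
      obtain ⟨x, m, hm⟩ := x
      simp only
      by_cases ha : a = m
      · rw [ha, hm, one_mul', one_mul', star_mul_mul]
      by_cases hb : b = m
      · rw [hb, hm, star_one', mul_one', mul_one', mul_star_mul]
      by_cases hc : c = m
      · simp [hc, hm, one_mul', mul_one']
      by_cases hac : a = c
      · rw [hac, mul_star_self', smul_mul_assoc, one_mul']
      by_cases hbc : b = c
      · rw [hbc, mul_star_self', mul_smul_comm, mul_one']
      have hab : a = b := by omega
      have : x b * star (x c) = star (x c * star (x b)) := by simp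
      rw [hab, this, star_mul_self', norm_mul', norm_star', mul_star_self', smul_smul]
      congr 1
      ring
    rw [key, mul_star_self', smul_smul]
    congr 1
    simp
    ring

theorem IsRankOneProjection.exists_mem {P : Fin 3 → Fin 3 → Octonion}
    (h : IsRankOneProjection P) : ∃ i, re (P i i) ≠ 0 := by
  by_contra! H
  simpa [H] using h.trace_eq_one

/-- The i-th column of P, scaled to have i-th entry 1, is the required triple: P_ai P_ib = P_ii P_ab
recovers P up to a real factor, and the trace condition makes the squared length of the triple 1 /
P_ii. -/
theorem IsRankOneProjection.emb_eq {P : Fin 3 → Fin 3 → Octonion} (h : IsRankOneProjection P)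
    {i : Fin 3} (hi : re (P i i) ≠ 0) : emb (ofCoords i (matrixCoords i P)) = P := by
  have hdiag (a) : P a a = re (P a a) • (1 : Octonion) := eq_re_smul_one (h.star_apply a a)
  have haff (a) : affine i (matrixCoords i P) a = (re (P i i))⁻¹ • P a i := by
    rcases Fin.eq_self_or_eq_succAbove i a with rfl | ⟨j, rfl⟩
    · rw [affine, Fin.insertNth_apply_same]
      conv_rhs => rw [hdiag a, re_smul, re_one, mul_one, smul_smul, inv_mul_cancel₀ hi, one_smul]
    · fin_cases j <;> simp [matrixCoords]
  have hnorm (a) : ‖P a i‖ ^ 2 = re (P i i) * re (P a a) := by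
    rw [norm_sq_eq_re, h.star_apply, h.mul_eq, re_smul]
  have hsum : denom (matrixCoords i P) = (re (P i i))⁻¹ := by
    have htr := h.trace_eq_one
    rw [Fin.sum_univ_succAbove _ i, Fin.sum_univ_two] at htr
    simp only [denom, matrixCoords, norm_smul, mul_pow, hnorm, Real.norm_eq_abs, sq_abs]
    field_simp
    linarith
  rw [emb_ofCoords, hsum, inv_inv]
  funext a b
  change re (P i i) • (affine i (matrixCoords i P) a * star (affine i (matrixCoords i P) b)) = _
  rw [haff, haff, star_smul, star_trivial, h.star_apply, smul_mul_assoc, mul_smul_comm, h.mul_eq,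
    smul_smul, smul_smul, smul_smul]
  convert one_smul ℝ (P a b) using 2
  field_simp

/-! ### Analyticity of the embedding and density of the affine charts -/

theorem contDiff_denom : ContDiff ℝ ω denom :=
  (contDiff_const.add ((contDiff_norm_sq ℝ).comp _root_.contDiff_fst)).add
    ((contDiff_norm_sq ℝ).comp _root_.contDiff_snd)

theorem contDiff_outer_affine (i : Fin 3) :
    ContDiff ℝ ω fun z => outer (affine i z) := by
  rw [contDiff_pi]
  intro a
  rw [contDiff_pi]
  intro b
  have h (c) : ContDiff ℝ ω fun z => affine i z c := contDiff_pi.mp (contDiff_insertNth i) c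
  exact ContDiff.comp (g := fun p : Octonion × Octonion => p.1 * p.2)
    (f := fun z => (affine i z a, star (affine i z b))) contDiff_mul
    ((h a).prodMk (ContDiff.comp (g := star) contDiff_star (h b)))

theorem contDiff_emb_ofCoords (i : Fin 3) : ContDiff ℝ ω fun z => emb (ofCoords i z) := by
  simp only [emb_ofCoords]
  exact (contDiff_denom.inv fun z => (denom_pos z).ne').smul (contDiff_outer_affine i)

theorem contDiffAt_matrixCoords {i : Fin 3} {P : Fin 3 → Fin 3 → Octonion}
    (h : re (P i i) ≠ 0) : ContDiffAt ℝ ω (matrixCoords i) P := by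
  have hap (a b : Fin 3) : ContDiff ℝ ω fun P : Fin 3 → Fin 3 → Octonion => P a b :=
    (contDiff_apply ℝ Octonion b).comp (contDiff_apply ℝ (Fin 3 → Octonion) a)
  have hinv : ContDiffAt ℝ ω (fun P : Fin 3 → Fin 3 → Octonion => (re (P i i))⁻¹) P :=
    (contDiff_re.comp (hap i i)).contDiffAt.inv h
  exact (hinv.smul (hap _ _).contDiffAt).prodMk (hinv.smul (hap _ _).contDiffAt)

theorem chart_mem_maximalAtlas (i : Fin 3) {n : ℕ∞ω} :
    chart i ∈ IsManifold.maximalAtlas 𝓘(ℝ, Octonion × Octonion) n OP2 :=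
  IsManifold.subset_maximalAtlas ⟨i, rfl⟩

theorem contMDiffOn_chart (i : Fin 3) : ContMDiffOn 𝓘(ℝ, Octonion × Octonion)
    𝓘(ℝ, Octonion × Octonion) ω (chart i) (chart i).source :=
  contMDiffOn_of_mem_maximalAtlas (chart_mem_maximalAtlas i)

theorem contMDiffAt_chart {i : Fin 3} {p : OP2} (h : p ∈ (chart i).source) :
    ContMDiffAt 𝓘(ℝ, Octonion × Octonion) 𝓘(ℝ, Octonion × Octonion) ω (chart i) p :=
  (contMDiffOn_chart i).contMDiffAt ((chart i).open_source.mem_nhds h)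

theorem contMDiff_ofCoords (i : Fin 3) : ContMDiff 𝓘(ℝ, Octonion × Octonion)
    𝓘(ℝ, Octonion × Octonion) ω (ofCoords i) := by
  rw [← contMDiffOn_univ]
  exact contMDiffOn_symm_of_mem_maximalAtlas (chart_mem_maximalAtlas i)

theorem emb_eventuallyEq {i : Fin 3} {p : OP2} (h : p ∈ (chart i).source) :
    emb =ᶠ[nhds p] (fun z => emb (ofCoords i z)) ∘ chart i := by
  filter_upwards [(chart i).open_source.mem_nhds h] with q hq
  exact congrArg emb (ofCoords_coords hq).symm

theorem contMDiff_emb : ContMDiff 𝓘(ℝ, Octonion × Octonion)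
    𝓘(ℝ, Fin 3 → Fin 3 → Octonion) ω emb := by
  intro p
  obtain ⟨i, hi⟩ := exists_mem_source p
  exact ((contDiff_emb_ofCoords i).contMDiff.contMDiffAt.comp p
    (contMDiffAt_chart hi)).congr_of_eventuallyEq (emb_eventuallyEq hi)

theorem continuous_emb : Continuous emb := contMDiff_emb.continuous

instance : T2Space OP2 := T2Space.of_injective_continuous emb_injective continuous_emb

theorem dense_range_ofCoords (i : Fin 3) : DenseRange (ofCoords i) := by
  intro p
  by_cases hp : p ∈ Set.range (ofCoords i)
  · exact subset_closure hp
  obtain ⟨⟨x, m, hm⟩, rfl⟩ := Quotient.exists_rep p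
  change proj _ ∉ _ at hp
  rw [proj_mem_range, not_not] at hp
  simp only at hp
  have him : m ≠ i := by
    rintro rfl
    exact one_ne_zero' (hm.symm.trans hp)
  -- Off the chart the i-th entry is 0. Replacing it by a real t ≠ 0 lands in the chart, and t → 0
  -- returns to the point; the triple stays reduced because its m-th entry is still 1.
  let γ : ℝ → OP2 := fun t => proj ⟨Function.update x i (t • (1 : Octonion)), m, by
    rw [Function.update_of_ne him, hm]⟩
  have hγ : Continuous γ := by
    refine isQuotientMap_proj.continuous.comp (Continuous.subtype_mk ?_ _)
    exact continuous_const.update i (continuous_id.smul continuous_const)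
  have h0 : γ 0 = Quotient.mk _ ⟨x, m, hm⟩ := by
    refine congrArg proj (Subtype.ext ?_)
    change Function.update x i ((0 : ℝ) • (1 : Octonion)) = x
    rw [zero_smul, ← hp, Function.update_eq_self]
  rw [← h0]
  have hmem : (0 : ℝ) ∈ closure {t : ℝ | t ≠ 0} := by
    rw [show {t : ℝ | t ≠ 0} = {0}ᶜ from rfl, (dense_compl_singleton (0 : ℝ)).closure_eq]
    trivial
  refine closure_mono ?_ (mem_closure_image hγ.continuousAt hmem)
  rintro _ ⟨t, ht, rfl⟩
  change proj _ ∈ _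
  rw [proj_mem_range]
  simpa using ⟨ht, one_ne_zero'⟩

/-! ### Reflections as linear maps of octonionic matrices -/

theorem matrix_ext {i : Fin 3} {P Q : Fin 3 → Fin 3 → Octonion}
    (hii : P i i = Q i i)
    (hi0 : P i (i.succAbove 0) = Q i (i.succAbove 0))
    (hi1 : P i (i.succAbove 1) = Q i (i.succAbove 1))
    (h0i : P (i.succAbove 0) i = Q (i.succAbove 0) i)
    (h1i : P (i.succAbove 1) i = Q (i.succAbove 1) i)
    (h00 : P (i.succAbove 0) (i.succAbove 0) = Q (i.succAbove 0) (i.succAbove 0))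
    (h01 : P (i.succAbove 0) (i.succAbove 1) = Q (i.succAbove 0) (i.succAbove 1))
    (h10 : P (i.succAbove 1) (i.succAbove 0) = Q (i.succAbove 1) (i.succAbove 0))
    (h11 : P (i.succAbove 1) (i.succAbove 1) = Q (i.succAbove 1) (i.succAbove 1)) : P = Q := by
  funext a b
  rcases Fin.eq_self_or_eq_succAbove i a with ha | ⟨j, ha⟩ <;>
  rcases Fin.eq_self_or_eq_succAbove i b with hb | ⟨k, hb⟩ <;> rw [ha, hb]
  · exact hii
  · fin_cases k <;> assumption
  · fin_cases j <;> assumption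
  · fin_cases j <;> fin_cases k <;> assumption

/-- The matrix with the given entries, the `i`-th row and column being listed first. -/
def ofEntries (i : Fin 3) (ii i0 i1 e0i e1i e00 e01 e10 e11 : Octonion) :
    Fin 3 → Fin 3 → Octonion :=
  i.insertNth (α := fun _ => Fin 3 → Octonion) (i.insertNth ii ![i0, i1])
    ![i.insertNth e0i ![e00, e01], i.insertNth e1i ![e10, e11]]

section
variable (i : Fin 3) (ii i0 i1 e0i e1i e00 e01 e10 e11 : Octonion)

@[simp] theorem ofEntries_self_self :
    ofEntries i ii i0 i1 e0i e1i e00 e01 e10 e11 i i = ii := by simp [ofEntries]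
@[simp] theorem ofEntries_self_zero :
    ofEntries i ii i0 i1 e0i e1i e00 e01 e10 e11 i (i.succAbove 0) = i0 := by simp [ofEntries]
@[simp] theorem ofEntries_self_one :
    ofEntries i ii i0 i1 e0i e1i e00 e01 e10 e11 i (i.succAbove 1) = i1 := by simp [ofEntries]
@[simp] theorem ofEntries_zero_self :
    ofEntries i ii i0 i1 e0i e1i e00 e01 e10 e11 (i.succAbove 0) i = e0i := by simp [ofEntries]
@[simp] theorem ofEntries_one_self :
    ofEntries i ii i0 i1 e0i e1i e00 e01 e10 e11 (i.succAbove 1) i = e1i := by simp [ofEntries]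
@[simp] theorem ofEntries_zero_zero :
    ofEntries i ii i0 i1 e0i e1i e00 e01 e10 e11 (i.succAbove 0) (i.succAbove 0) = e00 := by
  simp [ofEntries]
@[simp] theorem ofEntries_zero_one :
    ofEntries i ii i0 i1 e0i e1i e00 e01 e10 e11 (i.succAbove 0) (i.succAbove 1) = e01 := by
  simp [ofEntries]
@[simp] theorem ofEntries_one_zero :
    ofEntries i ii i0 i1 e0i e1i e00 e01 e10 e11 (i.succAbove 1) (i.succAbove 0) = e10 := by
  simp [ofEntries]
@[simp] theorem ofEntries_one_one :
    ofEntries i ii i0 i1 e0i e1i e00 e01 e10 e11 (i.succAbove 1) (i.succAbove 1) = e11 := by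
  simp [ofEntries]

end

/-- The amount by which a reflection lowers one diagonal entry and raises the other. -/
def diagShift (i : Fin 3) (r : ℝ) (lam : Octonion) (P : Fin 3 → Fin 3 → Octonion) : ℝ :=
  ‖lam‖ ^ 2 * (re (P (i.succAbove 0) (i.succAbove 0)) - re (P (i.succAbove 1) (i.succAbove 1)))
    - r * (inner ℝ lam (P (i.succAbove 0) (i.succAbove 1))
      + inner ℝ (star lam) (P (i.succAbove 1) (i.succAbove 0)))

/-- The coefficient of `λ` in the off-diagonal entry of a reflected matrix. -/
def offDiagShift (i : Fin 3) (r : ℝ) (lam : Octonion) (P : Fin 3 → Fin 3 → Octonion) : ℝ :=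
  r * (re (P (i.succAbove 0) (i.succAbove 0)) - re (P (i.succAbove 1) (i.succAbove 1)))
    + (inner ℝ lam (P (i.succAbove 0) (i.succAbove 1))
      + inner ℝ (star lam) (P (i.succAbove 1) (i.succAbove 0)))

/-- The linear map `P ↦ R P R*` for `R` the reflection matrix with rows `(r, λ)`, `(λ̄, -r)`
in the coordinates other than the `i`-th. -/
def reflectionLinear (i : Fin 3) (r : ℝ) (lam : Octonion) :
    (Fin 3 → Fin 3 → Octonion) →ₗ[ℝ] (Fin 3 → Fin 3 → Octonion) where
  -- For a Hermitian block with diagonal α, β and corner c, the corner of R P R* is r(α - β)λ - r²c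
  -- + λc̄λ, and λc̄λ = 2⟨λ,c⟩λ - |λ|²c. With r² + |λ|² = 1 this is (r(α - β) + 2⟨λ,c⟩)λ - c.
  -- Splitting 2⟨λ,c⟩ between the two corners extends the formula linearly to all matrices while
  -- keeping the norm.
  toFun P := ofEntries i (P i i)
    (r • P i (i.succAbove 0) + P i (i.succAbove 1) * star lam)
    (P i (i.succAbove 0) * lam - r • P i (i.succAbove 1))
    (r • P (i.succAbove 0) i + lam * P (i.succAbove 1) i)
    (star lam * P (i.succAbove 0) i - r • P (i.succAbove 1) i)
    (P (i.succAbove 0) (i.succAbove 0) - diagShift i r lam P • 1)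
    (offDiagShift i r lam P • lam - P (i.succAbove 0) (i.succAbove 1))
    (offDiagShift i r lam P • star lam - P (i.succAbove 1) (i.succAbove 0))
    (P (i.succAbove 1) (i.succAbove 1) + diagShift i r lam P • 1)
  map_add' P Q := by
    apply matrix_ext (i := i) <;>
      simp only [Pi.add_apply, ofEntries_self_self, ofEntries_self_zero, ofEntries_self_one,
        ofEntries_zero_self, ofEntries_one_self, ofEntries_zero_zero, ofEntries_zero_one,
        ofEntries_one_zero, ofEntries_one_one, diagShift, offDiagShift, re_add, inner_add_right,
        mul_add, add_mul] <;>
      module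
  map_smul' c P := by
    apply matrix_ext (i := i) <;>
      simp only [Pi.smul_apply, ofEntries_self_self, ofEntries_self_zero, ofEntries_self_one,
        ofEntries_zero_self, ofEntries_one_self, ofEntries_zero_zero, ofEntries_zero_one,
        ofEntries_one_zero, ofEntries_one_one, diagShift, offDiagShift, re_smul,
        real_inner_smul_right, mul_smul_comm, smul_mul_assoc, RingHom.id_apply] <;>
      module

/-- `reflectionLinear` as a continuous linear map. -/
def reflectionMatrix (i : Fin 3) (r : ℝ) (lam : Octonion) :
    (Fin 3 → Fin 3 → Octonion) →L[ℝ] (Fin 3 → Fin 3 → Octonion) :=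
  LinearMap.toContinuousLinearMap (reflectionLinear i r lam)

theorem reflectionMatrix_apply (i : Fin 3) (r : ℝ) (lam : Octonion)
    (P : Fin 3 → Fin 3 → Octonion) :
    reflectionMatrix i r lam P = ofEntries i (P i i)
      (r • P i (i.succAbove 0) + P i (i.succAbove 1) * star lam)
      (P i (i.succAbove 0) * lam - r • P i (i.succAbove 1))
      (r • P (i.succAbove 0) i + lam * P (i.succAbove 1) i)
      (star lam * P (i.succAbove 0) i - r • P (i.succAbove 1) i)
      (P (i.succAbove 0) (i.succAbove 0) - diagShift i r lam P • 1)
      (offDiagShift i r lam P • lam - P (i.succAbove 0) (i.succAbove 1))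
      (offDiagShift i r lam P • star lam - P (i.succAbove 1) (i.succAbove 0))
      (P (i.succAbove 1) (i.succAbove 1) + diagShift i r lam P • 1) := rfl

/-- The squared Hilbert-Schmidt norm. -/
def sqNorm (P : Fin 3 → Fin 3 → Octonion) : ℝ := ∑ a, ∑ b, ‖P a b‖ ^ 2

theorem sqNorm_eq (i : Fin 3) (P : Fin 3 → Fin 3 → Octonion) : sqNorm P =
    (‖P i i‖ ^ 2 + (‖P i (i.succAbove 0)‖ ^ 2 + ‖P i (i.succAbove 1)‖ ^ 2)) +
    ((‖P (i.succAbove 0) i‖ ^ 2 + (‖P (i.succAbove 0) (i.succAbove 0)‖ ^ 2 +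
      ‖P (i.succAbove 0) (i.succAbove 1)‖ ^ 2)) +
    (‖P (i.succAbove 1) i‖ ^ 2 + (‖P (i.succAbove 1) (i.succAbove 0)‖ ^ 2 +
      ‖P (i.succAbove 1) (i.succAbove 1)‖ ^ 2))) := by
  simp only [sqNorm, Fin.sum_univ_succAbove _ i, Fin.sum_univ_two]

theorem norm_sq_smul_add_mul (r : ℝ) (lam u v : Octonion) :
    ‖r • u + lam * v‖ ^ 2 =
      r ^ 2 * ‖u‖ ^ 2 + 2 * r * inner ℝ lam (u * star v) + ‖lam‖ ^ 2 * ‖v‖ ^ 2 := by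
  rw [norm_add_sq_real, real_inner_smul_left, inner_mul_right_eq, real_inner_comm, norm_smul,
    norm_mul', mul_pow, mul_pow, Real.norm_eq_abs, sq_abs]
  ring

theorem norm_sq_mul_sub_smul (r : ℝ) (lam u v : Octonion) :
    ‖star lam * u - r • v‖ ^ 2 =
      ‖lam‖ ^ 2 * ‖u‖ ^ 2 - 2 * r * inner ℝ lam (u * star v) + r ^ 2 * ‖v‖ ^ 2 := by
  rw [norm_sub_sq_real, real_inner_smul_right, norm_smul,
    norm_mul', mul_pow, mul_pow, Real.norm_eq_abs, sq_abs, norm_star', ← inner_mul_left_eq,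
    inner_mul_right_eq, real_inner_comm]
  ring

/-- The cross terms are ±2r⟨λ, u v̄⟩ and cancel. -/
theorem norm_sq_reflection {r : ℝ} {lam : Octonion} (h : r ^ 2 + ‖lam‖ ^ 2 = 1)
    (u v : Octonion) :
    ‖r • u + lam * v‖ ^ 2 + ‖star lam * u - r • v‖ ^ 2 = ‖u‖ ^ 2 + ‖v‖ ^ 2 := by
  rw [norm_sq_smul_add_mul, norm_sq_mul_sub_smul]
  linear_combination (‖u‖ ^ 2 + ‖v‖ ^ 2) * h

theorem norm_sq_sub_smul_one (a : Octonion) (c : ℝ) :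
    ‖a - c • (1 : Octonion)‖ ^ 2 = ‖a‖ ^ 2 - 2 * c * re a + c ^ 2 := by
  rw [norm_sub_sq_real, real_inner_smul_right, real_inner_comm, inner_one_left, norm_smul,
    norm_one', mul_one, Real.norm_eq_abs, sq_abs]
  ring

theorem norm_sq_smul_sub (a b : Octonion) (c : ℝ) :
    ‖c • a - b‖ ^ 2 = ‖b‖ ^ 2 - 2 * c * inner ℝ a b + c ^ 2 * ‖a‖ ^ 2 := by
  rw [norm_sub_sq_real, real_inner_smul_left, norm_smul, mul_pow, Real.norm_eq_abs, sq_abs]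
  ring

/-- The i-th column, and after conjugation the i-th row, transform by the norm-preserving reflection
of 𝕆². Only the remaining 2 × 2 block needs a separate computation. -/
theorem sqNorm_reflectionMatrix (i : Fin 3) {r : ℝ} {lam : Octonion}
    (h : r ^ 2 + ‖lam‖ ^ 2 = 1) (P : Fin 3 → Fin 3 → Octonion) :
    sqNorm (reflectionMatrix i r lam P) = sqNorm P := by
  rw [sqNorm_eq i, sqNorm_eq i P, reflectionMatrix_apply]
  simp only [ofEntries_self_self, ofEntries_self_zero, ofEntries_self_one,
    ofEntries_zero_self, ofEntries_one_self, ofEntries_zero_zero, ofEntries_zero_one,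
    ofEntries_one_zero, ofEntries_one_one]
  have hcol := norm_sq_reflection h (P (i.succAbove 0) i) (P (i.succAbove 1) i)
  have hrow := norm_sq_reflection h (star (P i (i.succAbove 0))) (star (P i (i.succAbove 1)))
  have e1 : r • star (P i (i.succAbove 0)) + lam * star (P i (i.succAbove 1)) =
      star (r • P i (i.succAbove 0) + P i (i.succAbove 1) * star lam) := by simp
  have e2 : star lam * star (P i (i.succAbove 0)) - r • star (P i (i.succAbove 1)) =
      star (P i (i.succAbove 0) * lam - r • P i (i.succAbove 1)) := by simp
  rw [e1, e2, norm_star', norm_star', norm_star', norm_star'] at hrow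
  have e3 : P (i.succAbove 1) (i.succAbove 1) + diagShift i r lam P • 1 =
      P (i.succAbove 1) (i.succAbove 1) - (-diagShift i r lam P) • 1 := by simp
  rw [e3, norm_sq_sub_smul_one, norm_sq_sub_smul_one, norm_sq_smul_sub, norm_sq_smul_sub,
    norm_star']
  -- Write D and O for the two shifts, δ for the difference of the diagonal real parts and S for the
  -- sum of the two inner products. Then D - δ = -rO and O|λ|² - S = rD, so the terms cancel; twice
  -- this expression is the change in squared norm of the block.
  have key : diagShift i r lam P *
        (diagShift i r lam P - (re (P (i.succAbove 0) (i.succAbove 0)) -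
          re (P (i.succAbove 1) (i.succAbove 1)))) +
      offDiagShift i r lam P * (offDiagShift i r lam P * ‖lam‖ ^ 2 -
        (inner ℝ lam (P (i.succAbove 0) (i.succAbove 1))
          + inner ℝ (star lam) (P (i.succAbove 1) (i.succAbove 0)))) = 0 := by
    have hl : ‖lam‖ ^ 2 = 1 - r ^ 2 := by linarith
    simp only [diagShift, offDiagShift, hl]
    ring
  linarith

theorem denom_reflectionCoords {r : ℝ} {lam : Octonion} (h : r ^ 2 + ‖lam‖ ^ 2 = 1)
    (z : Octonion × Octonion) : denom (reflectionCoords r lam z) = denom z := by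
  have := norm_sq_reflection h z.1 z.2
  simp only [denom, reflectionCoords]
  linarith

/-- This is where the linear map meets the reflection of the chart. The only entries that are not
immediate are the two corners, which contain (λv)(ūλ) or its conjugate; `moufang_reflection`
evaluates them. -/
theorem reflectionMatrix_outer (i : Fin 3) {r : ℝ} {lam : Octonion}
    (h : r ^ 2 + ‖lam‖ ^ 2 = 1) (z : Octonion × Octonion) :
    reflectionMatrix i r lam (outer (affine i z)) = outer (affine i (reflectionCoords r lam z)) := by
  obtain ⟨u, v⟩ := z
  have hl : ‖lam‖ ^ 2 = 1 - r ^ 2 := by linarith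
  have hinner : inner ℝ (star lam) (v * star u) = inner ℝ lam (u * star v) := by
    rw [← inner_star_star, star_star, star_mul, star_star]
  have hoff : (r • u + lam * v) * (star u * lam - r • star v) =
      (r * (‖u‖ ^ 2 - ‖v‖ ^ 2) + (inner ℝ lam (u * star v) + inner ℝ lam (u * star v))) • lam
        - u * star v := by
    rw [add_mul, mul_sub, mul_sub, moufang_reflection, smul_mul_assoc, smul_mul_assoc,
      mul_smul_comm, mul_smul_comm, mul_star_mul_left, mul_mul_star, hl]
    module
  rw [reflectionMatrix_apply]
  apply matrix_ext (i := i) <;>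
    simp only [ofEntries_self_self, ofEntries_self_zero, ofEntries_self_one,
      ofEntries_zero_self, ofEntries_one_self, ofEntries_zero_zero, ofEntries_zero_one,
      ofEntries_one_zero, ofEntries_one_one, outer, affine, Fin.insertNth_apply_same,
      Fin.insertNth_apply_succAbove, Matrix.cons_val_zero, Matrix.cons_val_one, reflectionCoords,
      one_mul', mul_one', star_one', diagShift, offDiagShift, hinner, mul_star_self', re_smul,
      re_one, mul_one, star_add, star_sub, star_mul, star_smul, star_star, star_trivial]
  · have e : r • star u + star v * star lam = star (r • u + lam * v) := by simp
    rw [e, mul_star_self', norm_sq_smul_add_mul, ← sub_smul, hl]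
    congr 1
    ring
  · exact hoff.symm
  · have e := congrArg star hoff
    simp only [star_mul, star_add, star_sub, star_smul, star_star, star_trivial] at e
    exact e.symm
  · have e : star u * lam - r • star v = star (star lam * u - r • v) := by simp
    rw [e, mul_star_self', norm_sq_mul_sub_smul, ← add_smul, hl]
    congr 1
    ring

theorem reflectionMatrix_emb_ofCoords (i : Fin 3) {r : ℝ} {lam : Octonion}
    (h : r ^ 2 + ‖lam‖ ^ 2 = 1) (z : Octonion × Octonion) :
    reflectionMatrix i r lam (emb (ofCoords i z)) =
      emb (ofCoords i (reflectionCoords r lam z)) := by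
  rw [emb_ofCoords, emb_ofCoords, map_smul, reflectionMatrix_outer i h, denom_reflectionCoords h]

/-! ### Global reflections -/

theorem isClosed_setOf_isRankOneProjection : IsClosed {P | IsRankOneProjection P} := by
  have hap (a b : Fin 3) : Continuous fun P : Fin 3 → Fin 3 → Octonion => P a b :=
    (continuous_apply b).comp (continuous_apply a)
  have hre (a : Fin 3) : Continuous fun P : Fin 3 → Fin 3 → Octonion => re (P a a) :=
    (contDiff_re (n := 0)).continuous.comp (hap a a)
  have hst : Continuous (star : Octonion → Octonion) := (contDiff_star (n := 0)).continuous
  have hmul : Continuous fun p : Octonion × Octonion => p.1 * p.2 :=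
    (contDiff_mul (n := 0)).continuous
  have : {P | IsRankOneProjection P} =
      (⋂ a, ⋂ b, {P | star (P a b) = P b a}) ∩ ({P | ∑ a, re (P a a) = 1} ∩
        ⋂ a, ⋂ b, ⋂ c, {P | P a c * P c b = re (P c c) • P a b}) := by
    ext P
    simp only [Set.mem_inter_iff, Set.mem_iInter, Set.mem_ofPred_eq]
    exact ⟨fun h => ⟨h.1, h.2, h.3⟩, fun h => ⟨h.1, h.2.1, h.2.2⟩⟩
  rw [this]
  refine IsClosed.inter ?_ (IsClosed.inter ?_ ?_)
  · exact isClosed_iInter fun a => isClosed_iInter fun b =>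
      isClosed_eq (hst.comp (hap a b)) (hap b a)
  · exact isClosed_eq (continuous_finsetSum _ fun a _ => hre a) continuous_const
  · exact isClosed_iInter fun a => isClosed_iInter fun b => isClosed_iInter fun c =>
      isClosed_eq (hmul.comp ((hap a c).prodMk (hap c b))) ((hre c).smul (hap a b))

/-- The condition is closed in p and holds on the dense i-th chart, where the matrix is again a
value of `emb`. -/
theorem isRankOneProjection_reflectionMatrix (i : Fin 3) {r : ℝ} {lam : Octonion}
    (h : r ^ 2 + ‖lam‖ ^ 2 = 1) (p : OP2) :
    IsRankOneProjection (reflectionMatrix i r lam (emb p)) := by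
  have hc : IsClosed {p | IsRankOneProjection (reflectionMatrix i r lam (emb p))} :=
    isClosed_setOf_isRankOneProjection.preimage
      ((reflectionMatrix i r lam).continuous.comp continuous_emb)
  refine (dense_range_ofCoords i).induction_on (p := fun p => IsRankOneProjection
    (reflectionMatrix i r lam (emb p))) p hc fun z => ?_
  rw [reflectionMatrix_emb_ofCoords i h]
  exact isRankOneProjection_emb _

/-- A map of `𝕆P²` which the embedding turns into a linear map is analytic. -/
theorem contMDiff_of_emb_comp {f : OP2 → OP2}
    (L : (Fin 3 → Fin 3 → Octonion) →L[ℝ] (Fin 3 → Fin 3 → Octonion))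
    (h : ∀ p, emb (f p) = L (emb p)) :
    ContMDiff 𝓘(ℝ, Octonion × Octonion) 𝓘(ℝ, Octonion × Octonion) ω f := by
  intro p
  obtain ⟨i, hi⟩ := exists_mem_source (f p)
  have hi' := (mem_source_iff i _).mp hi
  rw [h] at hi'
  have hL : ContMDiff 𝓘(ℝ, Octonion × Octonion) 𝓘(ℝ, Fin 3 → Fin 3 → Octonion) ω
      fun q => L (emb q) := L.contMDiff.comp contMDiff_emb
  have hm : ContMDiffAt 𝓘(ℝ, Octonion × Octonion) 𝓘(ℝ, Octonion × Octonion) ω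
      (fun q => ofCoords i (matrixCoords i (L (emb q)))) p :=
    (contMDiff_ofCoords i).contMDiffAt.comp p
      ((contDiffAt_matrixCoords hi').contMDiffAt.comp p hL.contMDiffAt)
  -- Near p the image stays in the i-th chart, where f is recovered from L ∘ `emb` by reading off
  -- quotients of entries.
  refine hm.congr_of_eventuallyEq ?_
  have hre : Continuous fun q => re (L (emb q) i i) :=
    (contDiff_re (n := 0)).continuous.comp
      ((continuous_apply i).comp ((continuous_apply i).comp hL.continuous))
  filter_upwards [(hre.isOpen_preimage _ isOpen_ne).mem_nhds hi'] with q hq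
  have hq' : f q ∈ (chart i).source := by
    rw [mem_source_iff, h]
    exact hq
  rw [← h, ← coords_eq_matrixCoords, ofCoords_coords hq']

theorem exists_isGlobalReflection (i : Fin 3) {r : ℝ} {lam : Octonion}
    (h : r ^ 2 + ‖lam‖ ^ 2 = 1) : ∃ f, IsGlobalReflection i r lam f := by
  have H (p : OP2) : ∃ q, emb q = reflectionMatrix i r lam (emb p) := by
    have hP := isRankOneProjection_reflectionMatrix i h p
    obtain ⟨j, hj⟩ := hP.exists_mem
    exact ⟨_, hP.emb_eq hj⟩
  choose f hf using H
  refine ⟨f, contMDiff_of_emb_comp _ hf, fun z => emb_injective ?_⟩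
  rw [hf, reflectionMatrix_emb_ofCoords i h]

theorem IsGlobalReflection.unique {i : Fin 3} {r : ℝ} {lam : Octonion} {f f' : OP2 → OP2}
    (hf : IsGlobalReflection i r lam f) (hf' : IsGlobalReflection i r lam f') : f = f' :=
  (dense_range_ofCoords i).equalizer hf.1.continuous hf'.1.continuous <|
    funext fun z => (hf.2 z).trans (hf'.2 z).symm

theorem IsGlobalReflection.emb_apply {i : Fin 3} {r : ℝ} {lam : Octonion} {f : OP2 → OP2}
    (hf : IsGlobalReflection i r lam f) (h : r ^ 2 + ‖lam‖ ^ 2 = 1) (p : OP2) :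
    emb (f p) = reflectionMatrix i r lam (emb p) := by
  refine congrFun ((dense_range_ofCoords i).equalizer (continuous_emb.comp hf.1.continuous)
    ((reflectionMatrix i r lam).continuous.comp continuous_emb) (funext fun z => ?_)) p
  simp only [Function.comp_apply]
  rw [hf.2, reflectionMatrix_emb_ofCoords i h]

theorem reflectionCoords_reflectionCoords {r : ℝ} {lam : Octonion}
    (h : r ^ 2 + ‖lam‖ ^ 2 = 1) (z : Octonion × Octonion) :
    reflectionCoords r lam (reflectionCoords r lam z) = z := by
  have hl : ‖lam‖ ^ 2 = 1 - r ^ 2 := by linarith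
  refine Prod.ext ?_ ?_
  · simp only [reflectionCoords, mul_sub, mul_smul_comm, mul_star_mul_left, hl]
    module
  · simp only [reflectionCoords, mul_add, mul_smul_comm, star_mul_mul, hl]
    module

theorem IsGlobalReflection.involutive {i : Fin 3} {r : ℝ} {lam : Octonion} {f : OP2 → OP2}
    (hf : IsGlobalReflection i r lam f) (h : r ^ 2 + ‖lam‖ ^ 2 = 1) : Function.Involutive f := by
  refine congrFun ((dense_range_ofCoords i).equalizer (hf.1.continuous.comp hf.1.continuous)
    continuous_id (funext fun z => ?_))
  simp only [Function.comp_apply]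
  rw [hf.2, hf.2, reflectionCoords_reflectionCoords h]

theorem cos_sq_add_norm_sin_sq (t : ℝ) :
    Real.cos t ^ 2 + ‖Real.sin t • (1 : Octonion)‖ ^ 2 = 1 := by
  rw [norm_smul, norm_one', mul_one, Real.norm_eq_abs, sq_abs, Real.cos_sq_add_sin_sq]

theorem one_sq_add_norm_zero_sq : (1 : ℝ) ^ 2 + ‖(0 : Octonion)‖ ^ 2 = 1 := by simp

theorem existsUnique_isRotation (t : ℝ) : ∃! f : OP2 → OP2, IsRotation t f := by
  obtain ⟨f₁, h₁⟩ := exists_isGlobalReflection 2 one_sq_add_norm_zero_sq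
  obtain ⟨f₂, h₂⟩ := exists_isGlobalReflection 2 (cos_sq_add_norm_sin_sq t)
  refine ⟨f₁ ∘ f₂, ⟨f₁, f₂, h₁, h₂, rfl⟩, ?_⟩
  rintro _ ⟨f₁', f₂', h₁', h₂', rfl⟩
  rw [h₁.unique h₁', h₂.unique h₂']

/-! ### The metric induced by the embedding -/

/-- The entry of an octonionic matrix as a continuous linear map. -/
def entryCLM (a b : Fin 3) : (Fin 3 → Fin 3 → Octonion) →L[ℝ] Octonion :=
  (ContinuousLinearMap.proj (R := ℝ) (φ := fun _ : Fin 3 => Octonion) b).comp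
    (ContinuousLinearMap.proj (R := ℝ) (φ := fun _ : Fin 3 => Fin 3 → Octonion) a)

/-- Half the Hilbert-Schmidt inner product of octonionic matrices. -/
def pairing : (Fin 3 → Fin 3 → Octonion) →L[ℝ] (Fin 3 → Fin 3 → Octonion) →L[ℝ] ℝ :=
  (2⁻¹ : ℝ) • ∑ a : Fin 3, ∑ b : Fin 3,
    (innerSL ℝ (E := Octonion)).bilinearComp (entryCLM a b) (entryCLM a b)

theorem pairing_apply (P Q : Fin 3 → Fin 3 → Octonion) :
    pairing P Q = 2⁻¹ * ∑ a, ∑ b, inner ℝ (P a b) (Q a b) := by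
  simp [pairing, entryCLM, sum_apply]

theorem pairing_comm (P Q : Fin 3 → Fin 3 → Octonion) : pairing P Q = pairing Q P := by
  simp only [pairing_apply, real_inner_comm]

theorem pairing_self (P : Fin 3 → Fin 3 → Octonion) : pairing P P = 2⁻¹ * sqNorm P := by
  simp only [pairing_apply, sqNorm, real_inner_self_eq_norm_sq]

theorem pairing_eq (i : Fin 3) (P Q : Fin 3 → Fin 3 → Octonion) : pairing P Q = 2⁻¹ *
    ((inner ℝ (P i i) (Q i i) + (inner ℝ (P i (i.succAbove 0)) (Q i (i.succAbove 0)) +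
      inner ℝ (P i (i.succAbove 1)) (Q i (i.succAbove 1)))) +
    ((inner ℝ (P (i.succAbove 0) i) (Q (i.succAbove 0) i) +
      (inner ℝ (P (i.succAbove 0) (i.succAbove 0)) (Q (i.succAbove 0) (i.succAbove 0)) +
      inner ℝ (P (i.succAbove 0) (i.succAbove 1)) (Q (i.succAbove 0) (i.succAbove 1)))) +
    (inner ℝ (P (i.succAbove 1) i) (Q (i.succAbove 1) i) +
      (inner ℝ (P (i.succAbove 1) (i.succAbove 0)) (Q (i.succAbove 1) (i.succAbove 0)) +
      inner ℝ (P (i.succAbove 1) (i.succAbove 1)) (Q (i.succAbove 1) (i.succAbove 1)))))) := by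
  simp only [pairing_apply, Fin.sum_univ_succAbove _ i, Fin.sum_univ_two]

/-- The derivative of `outer` at `x` in direction `y`. -/
def outerDeriv (x y : Fin 3 → Octonion) : Fin 3 → Fin 3 → Octonion :=
  fun a b => y a * star (x b) + x a * star (y b)

/-- The derivative of `affine` in direction `d`. -/
abbrev affineDir (i : Fin 3) (d : Octonion × Octonion) : Fin 3 → Octonion :=
  i.insertNth (0 : Octonion) ![d.1, d.2]

/-- The derivative of `denom` at `z` in direction `d`. -/
def denomDeriv (z d : Octonion × Octonion) : ℝ := 2 * inner ℝ z.1 d.1 + 2 * inner ℝ z.2 d.2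

theorem affine_add_smul (i : Fin 3) (z d : Octonion × Octonion) (t : ℝ) :
    affine i (z + t • d) = affine i z + t • affineDir i d := by
  funext a
  rcases Fin.eq_self_or_eq_succAbove i a with rfl | ⟨j, rfl⟩
  · simp [affine, affineDir]
  · fin_cases j <;> simp [affine, affineDir]

theorem outer_add_smul (x y : Fin 3 → Octonion) (t : ℝ) :
    outer (x + t • y) = outer x + (t • outerDeriv x y + t ^ 2 • outer y) := by
  funext a b
  simp only [outer, outerDeriv, Pi.add_apply, Pi.smul_apply, star_add, star_smul, star_trivial,
    add_mul, mul_add, smul_mul_assoc, mul_smul_comm]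
  module

theorem denom_add_smul (z d : Octonion × Octonion) (t : ℝ) :
    denom (z + t • d) = denom z + (t * denomDeriv z d + t ^ 2 * (‖d.1‖ ^ 2 + ‖d.2‖ ^ 2)) := by
  simp only [denom, denomDeriv, Prod.fst_add, Prod.snd_add, Prod.smul_fst, Prod.smul_snd,
    norm_add_sq_real, real_inner_smul_right, norm_smul, mul_pow, Real.norm_eq_abs, sq_abs]
  ring

theorem hasDerivAt_emb_line (i : Fin 3) (z d : Octonion × Octonion) :
    HasDerivAt (fun t : ℝ => emb (ofCoords i (z + t • d)))
      ((denom z)⁻¹ • outerDeriv (affine i z) (affineDir i d)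
        - (denomDeriv z d / denom z ^ 2) • outer (affine i z)) 0 := by
  have hquad {F : Type} [NormedAddCommGroup F] [NormedSpace ℝ F] (A B C : F) :
      HasDerivAt (fun t : ℝ => A + (t • B + t ^ 2 • C)) B 0 := by
    have h1 := ((hasDerivAt_id (0 : ℝ)).smul_const B).add
      (((hasDerivAt_id (0 : ℝ)).pow 2).smul_const C)
    simpa using h1.const_add A
  have hN : HasDerivAt (fun t : ℝ => denom (z + t • d)) (denomDeriv z d) 0 := by
    simp only [denom_add_smul]
    exact hquad _ _ _
  have hX : HasDerivAt (fun t : ℝ => outer (affine i (z + t • d)))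
      (outerDeriv (affine i z) (affineDir i d)) 0 := by
    simp only [affine_add_smul, outer_add_smul]
    exact hquad _ _ _
  simp only [emb_ofCoords]
  have h := (hN.fun_inv (denom_pos _).ne').smul hX
  simp only [zero_smul, add_zero] at h
  refine h.congr_deriv ?_
  module

/-- Differentiability is already known, so the derivative may be computed along lines, where
numerator and denominator are quadratic polynomials in t. -/
theorem fderiv_emb_ofCoords (i : Fin 3) (z d : Octonion × Octonion) :
    fderiv ℝ (fun z => emb (ofCoords i z)) z d =
      (denom z)⁻¹ • outerDeriv (affine i z) (affineDir i d)
        - (denomDeriv z d / denom z ^ 2) • outer (affine i z) := by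
  have h : HasFDerivAt (fun z => emb (ofCoords i z))
      (fderiv ℝ (fun z => emb (ofCoords i z)) z) z :=
    (((contDiff_emb_ofCoords i).differentiable (by simp)) z).hasFDerivAt
  exact (h.hasLineDerivAt d).unique (hasDerivAt_emb_line i z d)

theorem inner_mul_left_mul (a c d : Octonion) :
    inner ℝ (a * c) (a * d) = ‖a‖ ^ 2 * inner ℝ c d := by
  have := inner_mul_mul_add a a c d
  rw [real_inner_comm (a * c) (a * d), real_inner_self_eq_norm_sq] at this
  linarith

theorem inner_mul_right_mul (a b c : Octonion) :
    inner ℝ (a * c) (b * c) = inner ℝ a b * ‖c‖ ^ 2 := by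
  have := inner_mul_mul_add a b c c
  rw [real_inner_self_eq_norm_sq] at this
  linarith

/-- With X = x x*, N = |x|² and P = X/N, one has dP = dX/N - (dN/N²)X. Since ⟨X,X⟩ = N²/2, ⟨dX,X⟩ =
N dN/2 and ⟨dX,dX⟩ is the numerator of ds² plus dN²/2, all terms in dN cancel. -/
theorem pairing_fderiv_emb (i : Fin 3) (z d : Octonion × Octonion) :
    pairing (fderiv ℝ (fun z => emb (ofCoords i z)) z d)
      (fderiv ℝ (fun z => emb (ofCoords i z)) z d) = ds2 z d := by
  rw [fderiv_emb_ofCoords]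
  obtain ⟨u, v⟩ := z
  obtain ⟨p, q⟩ := d
  set x := affine i (u, v) with hx
  set y := affineDir i (p, q) with hy
  -- The mixed term of ds² arises here: the polarised composition law exchanges v̄ and q̄ between
  -- the two factors.
  have hcross : inner ℝ (p * star v) (u * star q) = 2 * (inner ℝ u p * inner ℝ v q) -
      re ((u * star v) * (q * star p)) := by
    have h := inner_mul_mul_add p u (star v) (star q)
    have h' : inner ℝ (p * star q) (u * star v) = re ((u * star v) * (q * star p)) := by
      rw [real_inner_comm, inner_eq_re, star_mul, star_star]
    rw [h', inner_star_star, real_inner_comm u p] at h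
    linarith
  have hXX : pairing (outer x) (outer x) = 2⁻¹ * denom (u, v) ^ 2 := by
    rw [pairing_eq i]
    simp only [hx, outer, affine, Fin.insertNth_apply_same,
      Fin.insertNth_apply_succAbove, Matrix.cons_val_zero, Matrix.cons_val_one, one_mul',
      mul_one', star_one', real_inner_self_eq_norm_sq, norm_star', norm_mul', norm_one', denom]
    ring
  have hdiag (u p : Octonion) : p * star u + u * star p = (2 * inner ℝ u p) • (1 : Octonion) := by
    rw [add_comm, mul_star_add_mul_star]
  have hAX (u v p q : Octonion) : inner ℝ (p * star v + u * star q) (u * star v) =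
      inner ℝ u p * ‖v‖ ^ 2 + ‖u‖ ^ 2 * inner ℝ v q := by
    rw [inner_add_left, inner_mul_right_mul, inner_mul_left_mul, inner_star_star, norm_star',
      real_inner_comm p u, real_inner_comm q v]
  have hAA : ‖p * star v + u * star q‖ ^ 2 = ‖p‖ ^ 2 * ‖v‖ ^ 2 +
      2 * (2 * (inner ℝ u p * inner ℝ v q) - re ((u * star v) * (q * star p))) +
      ‖u‖ ^ 2 * ‖q‖ ^ 2 := by
    rw [norm_add_sq_real, hcross, norm_mul', norm_mul', norm_star', norm_star', mul_pow, mul_pow]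
  have hAA' : ‖q * star u + v * star p‖ = ‖p * star v + u * star q‖ := by
    rw [← norm_star' (q * star u + v * star p)]
    simp [add_comm]
  have hDX : pairing (outerDeriv x y) (outer x) =
      2⁻¹ * (denomDeriv (u, v) (p, q) * denom (u, v)) := by
    rw [pairing_eq i]
    simp only [hx, hy, outer, outerDeriv, affine, affineDir, Fin.insertNth_apply_same,
      Fin.insertNth_apply_succAbove, Matrix.cons_val_zero, Matrix.cons_val_one, one_mul',
      mul_one', star_one', star_zero, mul_zero, zero_mul, zero_add, add_zero, inner_zero_left,
      inner_star_star, hAX]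
    simp only [denom, denomDeriv, real_inner_comm]
    ring
  have hDD : pairing (outerDeriv x y) (outerDeriv x y) =
      ‖p‖ ^ 2 * (1 + ‖v‖ ^ 2) + ‖q‖ ^ 2 * (1 + ‖u‖ ^ 2) - 2 * re ((u * star v) * (q * star p))
        + 2⁻¹ * denomDeriv (u, v) (p, q) ^ 2 := by
    rw [pairing_eq i]
    simp only [hx, hy, outerDeriv, affine, affineDir, Fin.insertNth_apply_same,
      Fin.insertNth_apply_succAbove, Matrix.cons_val_zero, Matrix.cons_val_one, one_mul',
      mul_one', star_one', star_zero, mul_zero, zero_mul, zero_add, add_zero,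
      real_inner_self_eq_norm_sq, hAA', norm_zero, hAA, norm_star']
    simp only [hdiag, norm_smul, mul_pow, Real.norm_eq_abs, sq_abs, norm_one', denomDeriv]
    ring
  simp only [map_sub, map_smul, sub_apply, smul_apply,
    smul_eq_mul, hXX, hDX, hDD, pairing_comm (outer x) (outerDeriv x y), ds2]
  have hN := (denom_pos (u, v)).ne'
  change _ = _ / denom (u, v) ^ 2
  field_simp
  ring

/-- By Cauchy-Schwarz and AM-GM the mixed term is at most |du|²|v|² + |dv|²|u|². The bound yields
both positive definiteness and boundedness of unit balls. -/
theorem ds2_ge (z d : Octonion × Octonion) :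
    (‖d.1‖ ^ 2 + ‖d.2‖ ^ 2) / denom z ^ 2 ≤ ds2 z d := by
  change _ ≤ _ / denom z ^ 2
  have hN := denom_pos z
  gcongr
  have h : re ((z.1 * star z.2) * (d.2 * star d.1)) ≤ (‖z.1‖ * ‖z.2‖) * (‖d.2‖ * ‖d.1‖) := by
    have h1 := real_inner_le_norm (z.1 * star z.2) (d.1 * star d.2)
    rw [inner_eq_re, star_mul, star_star, norm_mul', norm_mul', norm_star', norm_star'] at h1
    linarith
  nlinarith [sq_nonneg (‖d.1‖ * ‖z.2‖ - ‖d.2‖ * ‖z.1‖)]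

/-- The metric in the coordinates of the `i`-th chart. -/
def localMetric (i : Fin 3) (z : Octonion × Octonion) :
    (Octonion × Octonion) →L[ℝ] (Octonion × Octonion) →L[ℝ] ℝ :=
  pairing.bilinearComp (fderiv ℝ (fun z => emb (ofCoords i z)) z)
    (fderiv ℝ (fun z => emb (ofCoords i z)) z)

theorem localMetric_self (i : Fin 3) (z d : Octonion × Octonion) :
    localMetric i z d d = ds2 z d := pairing_fderiv_emb i z d

/-- In finite dimension, smoothness of a family of bilinear forms can be tested on fixed pairs of
vectors. -/
theorem contDiff_localMetric (i : Fin 3) : ContDiff ℝ ∞ (localMetric i) := by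
  rw [contDiff_clm_apply_iff]
  intro d
  rw [contDiff_clm_apply_iff]
  intro d'
  have h (d) : ContDiff ℝ ∞ fun z => fderiv ℝ (fun z => emb (ofCoords i z)) z d :=
    (((contDiff_emb_ofCoords i).of_le le_top).fderiv_right (m := ∞) le_rfl).clm_apply contDiff_const
  exact (pairing.contDiff.comp (h d)).clm_apply (h d')

/-- The derivative of the embedding. -/
def dEmb (p : OP2) : (Octonion × Octonion) →L[ℝ] (Fin 3 → Fin 3 → Octonion) :=
  mfderiv 𝓘(ℝ, Octonion × Octonion) 𝓘(ℝ, Fin 3 → Fin 3 → Octonion) emb p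

theorem dEmb_apply {i : Fin 3} {p : OP2} (h : p ∈ (chart i).source)
    (w : TangentSpace 𝓘(ℝ, Octonion × Octonion) p) :
    dEmb p w = fderiv ℝ (fun z => emb (ofCoords i z)) (chart i p)
      (mfderiv 𝓘(ℝ, Octonion × Octonion) 𝓘(ℝ, Octonion × Octonion) (chart i) p w) := by
  have h1 : MDifferentiableAt 𝓘(ℝ, Octonion × Octonion) 𝓘(ℝ, Octonion × Octonion) (chart i) p :=
    (contMDiffAt_chart h).mdifferentiableAt (by simp)
  have h2 : MDifferentiableAt 𝓘(ℝ, Octonion × Octonion) 𝓘(ℝ, Fin 3 → Fin 3 → Octonion)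
      (fun z => emb (ofCoords i z)) (chart i p) :=
    ((contDiff_emb_ofCoords i).contMDiff.mdifferentiable (by simp)) _
  rw [dEmb, (emb_eventuallyEq h).mfderiv_eq, mfderiv_comp p h2 h1, mfderiv_eq_fderiv]
  rfl

/-- The bilinear form induced by the embedding on a tangent space. -/
def inducedForm (p : OP2) : (Octonion × Octonion) →L[ℝ] (Octonion × Octonion) →L[ℝ] ℝ :=
  pairing.bilinearComp (dEmb p) (dEmb p)

theorem inducedForm_apply (p : OP2) (w w' : TangentSpace 𝓘(ℝ, Octonion × Octonion) p) :
    inducedForm p w w' = pairing (dEmb p w) (dEmb p w') := rfl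

theorem inducedForm_eq {i : Fin 3} {p : OP2} (h : p ∈ (chart i).source)
    (w w' : TangentSpace 𝓘(ℝ, Octonion × Octonion) p) :
    inducedForm p w w' = localMetric i (chart i p)
      (mfderiv 𝓘(ℝ, Octonion × Octonion) 𝓘(ℝ, Octonion × Octonion) (chart i) p w)
      (mfderiv 𝓘(ℝ, Octonion × Octonion) 𝓘(ℝ, Octonion × Octonion) (chart i) p w') := by
  rw [inducedForm_apply, dEmb_apply h, dEmb_apply h]
  rfl

theorem inducedForm_self {i : Fin 3} {p : OP2} (h : p ∈ (chart i).source)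
    (w : TangentSpace 𝓘(ℝ, Octonion × Octonion) p) :
    inducedForm p w w = ds2 (chart i p)
      (mfderiv 𝓘(ℝ, Octonion × Octonion) 𝓘(ℝ, Octonion × Octonion) (chart i) p w) := by
  rw [inducedForm_eq h]
  exact localMetric_self _ _ _

/-! ### Positivity and boundedness of the induced form -/

theorem mdifferentiable_chart (i : Fin 3) : (chart i).MDifferentiable 𝓘(ℝ, Octonion × Octonion)
    𝓘(ℝ, Octonion × Octonion) :=
  have : IsManifold 𝓘(ℝ, Octonion × Octonion) 1 OP2 := .of_le (n := ω) le_top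
  mdifferentiable_of_mem_atlas (show chart i ∈ Set.range chart from ⟨i, rfl⟩)

theorem inducedForm_pos (p : OP2) {w : TangentSpace 𝓘(ℝ, Octonion × Octonion) p} (hw : w ≠ 0) :
    0 < inducedForm p w w := by
  obtain ⟨i, hi⟩ := exists_mem_source p
  rw [inducedForm_self hi]
  have hd : mfderiv 𝓘(ℝ, Octonion × Octonion) 𝓘(ℝ, Octonion × Octonion) (chart i) p w ≠ 0 :=
    fun h => hw ((mdifferentiable_chart i).mfderiv_injective hi (h.trans (map_zero _).symm))
  generalize mfderiv 𝓘(ℝ, Octonion × Octonion) 𝓘(ℝ, Octonion × Octonion) (chart i) p w = d at *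
  change Octonion × Octonion at d
  refine lt_of_lt_of_le ?_ (ds2_ge _ _)
  have := denom_pos (chart i p)
  refine div_pos ?_ (by positivity)
  by_contra! h
  refine hd (Prod.ext ?_ ?_)
  · exact norm_eq_zero.mp (by nlinarith [sq_nonneg ‖d.1‖, sq_nonneg ‖d.2‖])
  · exact norm_eq_zero.mp (by nlinarith [sq_nonneg ‖d.1‖, sq_nonneg ‖d.2‖])

theorem isVonNBounded_inducedForm (p : OP2) : Bornology.IsVonNBounded ℝ
    {w : TangentSpace 𝓘(ℝ, Octonion × Octonion) p | inducedForm p w w < 1} := by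
  obtain ⟨i, hi⟩ := exists_mem_source p
  have hN := denom_pos (chart i p)
  have hb : Bornology.IsVonNBounded ℝ
      (Metric.closedBall (0 : Octonion × Octonion) (denom (chart i p))) :=
    NormedSpace.isVonNBounded_closedBall ℝ _ _
  let A : (Octonion × Octonion) →L[ℝ] TangentSpace 𝓘(ℝ, Octonion × Octonion) p :=
    mfderiv 𝓘(ℝ, Octonion × Octonion) 𝓘(ℝ, Octonion × Octonion) (chart i).symm (chart i p)
  -- By `ds2_ge`, a tangent vector of length less than 1 has both coordinate components of norm at
  -- most `denom`, so it is the image of a point of that closed ball under the inverse chart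
  -- differential.
  refine (hb.image A).subset fun w hw => ?_
  refine ⟨mfderiv 𝓘(ℝ, Octonion × Octonion) 𝓘(ℝ, Octonion × Octonion) (chart i) p w, ?_,
    DFunLike.congr_fun ((mdifferentiable_chart i).symm_comp_deriv hi) w⟩
  change inducedForm p w w < 1 at hw
  rw [inducedForm_self hi] at hw
  generalize mfderiv 𝓘(ℝ, Octonion × Octonion) 𝓘(ℝ, Octonion × Octonion) (chart i) p w = d at *
  change Octonion × Octonion at d
  have h := (ds2_ge (chart i p) d).trans_lt hw
  rw [div_lt_one (by positivity)] at h
  rw [mem_closedBall_zero_iff, Prod.norm_def, max_le_iff]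
  constructor
  · exact le_of_sq_le_sq (by nlinarith [sq_nonneg ‖d.2‖]) hN.le
  · exact le_of_sq_le_sq (by nlinarith [sq_nonneg ‖d.1‖]) hN.le

/-- The chart used by the charted space structure at `p`. -/
def chartIndex (p : OP2) : Fin 3 := (exists_mem_source p).choose

theorem mem_source_chartIndex (p : OP2) : p ∈ (chart (chartIndex p)).source :=
  (exists_mem_source p).choose_spec

/-! ### Bilinear forms on the tangent bundle in chart coordinates -/

section

variable {E M : Type*} [NormedAddCommGroup E] [NormedSpace ℝ E] [TopologicalSpace M]
  [ChartedSpace E M] [IsManifold 𝓘(ℝ, E) 1 M]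

/-- On fibres, the preferred trivialization of the tangent bundle is the differential of the
preferred chart. -/
theorem mfderiv_chartAt_trivializationAt_symm {p q : M} (hq : q ∈ (chartAt E p).source) (v : E) :
    mfderiv 𝓘(ℝ, E) 𝓘(ℝ, E) (chartAt E p) q
      ((trivializationAt E (TangentSpace 𝓘(ℝ, E)) p).symm q v) = v := by
  have hb : q ∈ (trivializationAt E (TangentSpace 𝓘(ℝ, E)) p).baseSet := hq
  have e := TangentBundle.continuousLinearMapAt_trivializationAt (I := 𝓘(ℝ, E)) hq
  have e' := (trivializationAt E
    (TangentSpace 𝓘(ℝ, E)) p).continuousLinearMapAt_symmL (R := ℝ) hb v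
  rw [e, Bundle.Trivialization.symmL_apply _ hb] at e'
  exact e'

/-- A bilinear form on a tangent space which is `G` in the preferred chart at `p` has
coordinates `G` in the bundle of bilinear forms. -/
theorem inCoordinates_bilinearForm {p q : M} (hq : q ∈ (chartAt E p).source)
    (φ : TangentSpace 𝓘(ℝ, E) q →L[ℝ] TangentSpace 𝓘(ℝ, E) q →L[ℝ] Bundle.Trivial M ℝ q)
    (G : E →L[ℝ] E →L[ℝ] ℝ)
    (h : ∀ v w, φ v w = G (mfderiv 𝓘(ℝ, E) 𝓘(ℝ, E) (chartAt E p) q v)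
      (mfderiv 𝓘(ℝ, E) 𝓘(ℝ, E) (chartAt E p) q w)) :
    ContinuousLinearMap.inCoordinates E (TangentSpace 𝓘(ℝ, E)) (E →L[ℝ] ℝ)
      (fun b : M => TangentSpace 𝓘(ℝ, E) b →L[ℝ] Bundle.Trivial M ℝ b) p q p q φ = G := by
  have hb : q ∈ (trivializationAt E (TangentSpace 𝓘(ℝ, E)) p).baseSet := hq
  refine ContinuousLinearMap.ext fun v => ContinuousLinearMap.ext fun w => ?_
  refine (inCoordinates_apply_eq₂ hb hb (Set.mem_univ _)).trans ?_
  refine (DFunLike.congr_fun (Bundle.Trivial.linearMapAt_trivialization ℝ M ℝ q) _).trans ?_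
  refine (h _ _).trans ?_
  exact congrArg₂ (fun a b => G a b) (mfderiv_chartAt_trivializationAt_symm hq v)
    (mfderiv_chartAt_trivializationAt_symm hq w)

end

instance : IsManifold 𝓘(ℝ, Octonion × Octonion) 1 OP2 := .of_le (n := ω) le_top

theorem contMDiff_inducedForm :
    ContMDiff 𝓘(ℝ, Octonion × Octonion) (𝓘(ℝ, Octonion × Octonion).prod
      𝓘(ℝ, (Octonion × Octonion) →L[ℝ] (Octonion × Octonion) →L[ℝ] ℝ)) ∞
      (fun p : OP2 => Bundle.TotalSpace.mk'
        ((Octonion × Octonion) →L[ℝ] (Octonion × Octonion) →L[ℝ] ℝ)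
        (E := fun p : OP2 => TangentSpace 𝓘(ℝ, Octonion × Octonion) p →L[ℝ]
          TangentSpace 𝓘(ℝ, Octonion × Octonion) p →L[ℝ] Bundle.Trivial OP2 ℝ p)
        p (inducedForm p)) := by
  intro p
  rw [contMDiffAt_hom_bundle]
  refine ⟨contMDiffAt_id, ?_⟩
  have hi := mem_source_chartIndex p
  have h : ContMDiffAt 𝓘(ℝ, Octonion × Octonion)
      𝓘(ℝ, (Octonion × Octonion) →L[ℝ] (Octonion × Octonion) →L[ℝ] ℝ) ∞
      (fun q => localMetric (chartIndex p) (chart (chartIndex p) q)) p :=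
    (contDiff_localMetric _).contMDiff.contMDiffAt.comp p ((contMDiffAt_chart hi).of_le le_top)
  refine h.congr_of_eventuallyEq ?_
  filter_upwards [(chart (chartIndex p)).open_source.mem_nhds hi] with q hq
  exact inCoordinates_bilinearForm (M := OP2) hq _ _ (inducedForm_eq hq)

/-- The Riemannian metric induced by the embedding. -/
def inducedMetric : SmoothMetric where
  inner p := inducedForm p
  symm _ _ _ := pairing_comm _ _
  pos p _ hv := inducedForm_pos p hv
  isVonNBounded p := isVonNBounded_inducedForm p
  contMDiff := contMDiff_inducedForm

theorem isOctonionicMetric_inducedMetric : IsOctonionicMetric inducedMetric :=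
  fun _ _ hp w => inducedForm_self hp w

/-! ### Uniqueness of the metric -/

theorem polarization {V : Type*} [AddCommGroup V] [Module ℝ V] [TopologicalSpace V]
    {B B' : V →L[ℝ] V →L[ℝ] ℝ} (hB : ∀ v w, B v w = B w v) (hB' : ∀ v w, B' v w = B' w v)
    (h : ∀ v, B v v = B' v v) (v w : V) : B v w = B' v w := by
  have := h (v + w)
  simp only [map_add, add_apply, h v, h w, hB w v, hB' w v] at this
  linarith

/-- The expression ds² prescribes only the quadratic form, and polarisation supplies the rest.
Besides uniqueness, this reduces the isometry property to a statement about matrices. -/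
theorem IsOctonionicMetric.inner_eq {g : SmoothMetric} (hg : IsOctonionicMetric g) (p : OP2)
    (w w' : TangentSpace 𝓘(ℝ, Octonion × Octonion) p) :
    g.inner p w w' = pairing (dEmb p w) (dEmb p w') := by
  refine polarization (B' := inducedMetric.inner p) (g.symm p) (inducedMetric.symm p)
    (fun v => ?_) w w'
  obtain ⟨i, hi⟩ := exists_mem_source p
  rw [hg i p hi, isOctonionicMetric_inducedMetric i p hi]

theorem existsUnique_isOctonionicMetric : ∃! g : SmoothMetric, IsOctonionicMetric g := by
  refine ⟨inducedMetric, isOctonionicMetric_inducedMetric, fun g hg => ?_⟩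
  have h : g.inner = inducedMetric.inner := by
    funext p
    ext w w'
    exact hg.inner_eq p w w'
  cases g
  cases h
  rfl

/-! ### Isometries -/

theorem IsRiemannianIsometry.comp {g : SmoothMetric} {f f' : OP2 → OP2}
    (hf : IsRiemannianIsometry g f) (hf' : IsRiemannianIsometry g f') :
    IsRiemannianIsometry g (f ∘ f') := by
  obtain ⟨Φ, rfl, hΦ⟩ := hf
  obtain ⟨Ψ, rfl, hΨ⟩ := hf'
  refine ⟨Ψ.trans Φ, rfl, fun p w w' => ?_⟩
  have h : mfderiv 𝓘(ℝ, Octonion × Octonion) 𝓘(ℝ, Octonion × Octonion) (Ψ.trans Φ) p =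
      (mfderiv 𝓘(ℝ, Octonion × Octonion) 𝓘(ℝ, Octonion × Octonion) Φ (Ψ p)).comp
        (mfderiv 𝓘(ℝ, Octonion × Octonion) 𝓘(ℝ, Octonion × Octonion) Ψ p) :=
    mfderiv_comp p (Φ.mdifferentiable (by simp) _) (Ψ.mdifferentiable (by simp) _)
  rw [h]
  exact (hΦ _ _ _).trans (hΨ _ _ _)

theorem IsRiemannianIsometry.id (g : SmoothMetric) : IsRiemannianIsometry g id := by
  refine ⟨Diffeomorph.refl _ _ _, rfl, fun p w w' => ?_⟩
  have h : mfderiv 𝓘(ℝ, Octonion × Octonion) 𝓘(ℝ, Octonion × Octonion)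
      (Diffeomorph.refl 𝓘(ℝ, Octonion × Octonion) OP2 ∞) p =
        ContinuousLinearMap.id ℝ (TangentSpace 𝓘(ℝ, Octonion × Octonion) p) := mfderiv_id
  rw [h]
  rfl

theorem IsRiemannianIsometry.exists_inverse {g : SmoothMetric} {f : OP2 → OP2}
    (hf : IsRiemannianIsometry g f) :
    ∃ f', IsRiemannianIsometry g f' ∧ ∀ p, f' (f p) = p := by
  obtain ⟨Φ, rfl, hΦ⟩ := hf
  refine ⟨Φ.symm, ⟨Φ.symm, rfl, fun p w w' => ?_⟩, Φ.symm_apply_apply⟩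
  have h : (mfderiv 𝓘(ℝ, Octonion × Octonion) 𝓘(ℝ, Octonion × Octonion) Φ (Φ.symm p)).comp
      (mfderiv 𝓘(ℝ, Octonion × Octonion) 𝓘(ℝ, Octonion × Octonion) Φ.symm p) =
        ContinuousLinearMap.id ℝ (TangentSpace 𝓘(ℝ, Octonion × Octonion) p) := by
    rw [← mfderiv_comp p (Φ.mdifferentiable (by simp) _) (Φ.symm.mdifferentiable (by simp) _)]
    have e : Φ ∘ Φ.symm = _root_.id := funext Φ.apply_symm_apply
    rw [e]
    exact mfderiv_id
  have h' (w : TangentSpace 𝓘(ℝ, Octonion × Octonion) p) :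
      mfderiv 𝓘(ℝ, Octonion × Octonion) 𝓘(ℝ, Octonion × Octonion) Φ (Φ.symm p)
        (mfderiv 𝓘(ℝ, Octonion × Octonion) 𝓘(ℝ, Octonion × Octonion) Φ.symm p w) = w :=
    DFunLike.congr_fun h w
  -- All tangent spaces are definitionally the model space, so the base point Φ(Φ⁻¹ p) can be
  -- replaced by p with the vectors left unchanged.
  have hcast (q : OP2) (hq : q = p) (a b : Octonion × Octonion) :
      g.inner q a b = g.inner p a b := by
    subst hq
    rfl
  rw [← hΦ]
  exact (congrArg₂ (fun a b => g.inner (Φ (Φ.symm p)) a b) (h' w) (h' w')).trans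
    (hcast _ (Φ.apply_symm_apply p) w w')

theorem pairing_reflectionMatrix (i : Fin 3) {r : ℝ} {lam : Octonion}
    (h : r ^ 2 + ‖lam‖ ^ 2 = 1) (P Q : Fin 3 → Fin 3 → Octonion) :
    pairing (reflectionMatrix i r lam P) (reflectionMatrix i r lam Q) = pairing P Q := by
  have hq (P) : pairing (reflectionMatrix i r lam P) (reflectionMatrix i r lam P) =
      pairing P P := by
    rw [pairing_self, pairing_self, sqNorm_reflectionMatrix i h]
  have := hq (P + Q)
  simp only [map_add, add_apply, hq, pairing_comm Q P,
    pairing_comm (reflectionMatrix i r lam Q) (reflectionMatrix i r lam P)] at this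
  linarith

theorem IsGlobalReflection.isRiemannianIsometry {g : SmoothMetric} (hg : IsOctonionicMetric g)
    {i : Fin 3} {r : ℝ} {lam : Octonion} {f : OP2 → OP2}
    (hf : IsGlobalReflection i r lam f) (h : r ^ 2 + ‖lam‖ ^ 2 = 1) :
    IsRiemannianIsometry g f := by
  have hs : ContMDiff 𝓘(ℝ, Octonion × Octonion) 𝓘(ℝ, Octonion × Octonion) ∞ f :=
    hf.1.of_le le_top
  refine ⟨⟨(hf.involutive h).toPerm f, hs, hs⟩, rfl, fun p w w' => ?_⟩
  change g.inner (f p) (mfderiv _ _ f p w) (mfderiv _ _ f p w') = _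
  have key (w : TangentSpace 𝓘(ℝ, Octonion × Octonion) p) :
      dEmb (f p) (mfderiv 𝓘(ℝ, Octonion × Octonion) 𝓘(ℝ, Octonion × Octonion) f p w) =
        reflectionMatrix i r lam (dEmb p w) := by
    have hemb := contMDiff_emb.mdifferentiable (by simp)
    have h₁ := mfderiv_comp p (hemb (f p)) (hf.1.mdifferentiable (by simp) p)
    have h₂ := mfderiv_comp p ((reflectionMatrix i r lam).contMDiff.mdifferentiable
      (n := ω) (by simp) (emb p)) (hemb p)
    -- Differentiating this intertwining relation shows that df corresponds to the linear map
    -- itself, which preserves the pairing.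
    have e : emb ∘ f = reflectionMatrix i r lam ∘ emb := funext (hf.emb_apply h)
    rw [e, h₂, mfderiv_eq_fderiv, ContinuousLinearMap.fderiv] at h₁
    exact (DFunLike.congr_fun h₁ w).symm
  rw [hg.inner_eq, hg.inner_eq, key, key, pairing_reflectionMatrix i h]

theorem IsRotation.isRiemannianIsometry {g : SmoothMetric} (hg : IsOctonionicMetric g)
    {t : ℝ} {f : OP2 → OP2} (hf : IsRotation t f) : IsRiemannianIsometry g f := by
  obtain ⟨f₁, f₂, h₁, h₂, rfl⟩ := hf
  exact (h₁.isRiemannianIsometry hg one_sq_add_norm_zero_sq).comp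
    (h₂.isRiemannianIsometry hg (cos_sq_add_norm_sin_sq t))

theorem IsComposite.isRiemannianIsometry {g : SmoothMetric} (hg : IsOctonionicMetric g)
    {f : OP2 → OP2} (hf : IsComposite f) : IsRiemannianIsometry g f := by
  induction hf with
  | refl => exact IsRiemannianIsometry.id g
  | reflection_comp r lam ρ f h hρ _ ih => exact (hρ.isRiemannianIsometry hg h).comp ih
  | rotation_comp t ρ f hρ _ ih => exact (hρ.isRiemannianIsometry hg).comp ih

/-! ### Transitivity -/

/-- The matrix `y yᵀ` of a real vector. -/
def realOuter (y : Fin 3 → ℝ) : Fin 3 → Fin 3 → Octonion := fun a b => (y a * y b) • 1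

/-- On real vectors the map is an ordinary plane reflection. The matrix form serves at points
outside the i-th chart, where the coordinate formula says nothing: [1,0,0] is not in U₃ and [0,1,0]
is not in U₁. -/
theorem reflectionMatrix_realOuter (i : Fin 3) {r s : ℝ} (h : r ^ 2 + s ^ 2 = 1)
    (y : Fin 3 → ℝ) :
    reflectionMatrix i r (s • 1) (realOuter y) = realOuter (i.insertNth (y i)
      ![r * y (i.succAbove 0) + s * y (i.succAbove 1),
        s * y (i.succAbove 0) - r * y (i.succAbove 1)]) := by
  have hs : s ^ 2 = 1 - r ^ 2 := by linarith
  have hd : diagShift i r (s • 1) (realOuter y) =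
      s ^ 2 * (y (i.succAbove 0) ^ 2 - y (i.succAbove 1) ^ 2)
        - 2 * r * s * (y (i.succAbove 0) * y (i.succAbove 1)) := by
    simp only [diagShift, realOuter, norm_smul, norm_one', star_smul, star_one', star_trivial,
      real_inner_smul_left, real_inner_smul_right, real_inner_self_eq_norm_sq, re_smul, re_one,
      Real.norm_eq_abs, mul_one, sq_abs]
    ring
  have ho : offDiagShift i r (s • 1) (realOuter y) =
      r * (y (i.succAbove 0) ^ 2 - y (i.succAbove 1) ^ 2)
        + 2 * s * (y (i.succAbove 0) * y (i.succAbove 1)) := by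
    simp only [offDiagShift, realOuter, norm_one', star_smul, star_one', star_trivial,
      real_inner_smul_left, real_inner_smul_right, real_inner_self_eq_norm_sq, re_smul, re_one,
      mul_one]
    ring
  rw [reflectionMatrix_apply, hd, ho]
  apply matrix_ext (i := i) <;>
    simp only [ofEntries_self_self, ofEntries_self_zero, ofEntries_self_one,
      ofEntries_zero_self, ofEntries_one_self, ofEntries_zero_zero, ofEntries_zero_one,
      ofEntries_one_zero, ofEntries_one_one, realOuter, Fin.insertNth_apply_same,
      Fin.insertNth_apply_succAbove, Matrix.cons_val_zero, Matrix.cons_val_one, mul_smul_comm,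
      smul_mul_assoc, mul_one', smul_smul, star_smul, star_one', star_trivial, ← add_smul,
      ← sub_smul] <;>
    congr 1
  · ring
  · ring
  · ring
  · ring
  · linear_combination (- y (i.succAbove 0) ^ 2) * hs
  · linear_combination (y (i.succAbove 0) * y (i.succAbove 1)) * hs
  · linear_combination (y (i.succAbove 0) * y (i.succAbove 1)) * hs
  · linear_combination (- y (i.succAbove 1) ^ 2) * hs

theorem emb_ofCoords_tan {θ : ℝ} (h : Real.cos θ ≠ 0) :
    emb (ofCoords 0 (Real.tan θ • 1, 0)) = realOuter ![Real.cos θ, Real.sin θ, 0] := by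
  have hd : (denom (Real.tan θ • 1, 0))⁻¹ = Real.cos θ ^ 2 := by
    simp only [denom, norm_smul, norm_one', norm_zero, Real.norm_eq_abs, mul_one, sq_abs]
    rw [← Real.inv_one_add_tan_sq h]
    simp
  have ht : Real.sin θ = Real.cos θ * Real.tan θ := by rw [mul_comm, Real.tan_mul_cos h]
  rw [emb_ofCoords, hd, ht]
  funext a b
  fin_cases a <;> fin_cases b <;>
    simp [outer, affine, realOuter, mul_one', smul_smul, smul_mul_assoc, mul_smul_comm] <;>
    ring_nf

theorem emb_ofCoords_zero (i : Fin 3) :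
    emb (ofCoords i (0, 0)) = realOuter (i.insertNth 1 ![0, 0]) := by
  rw [emb_ofCoords]
  apply matrix_ext (i := i) <;> simp [outer, affine, realOuter, mul_one', denom]

theorem emb_ofCoords_zero_one : emb (ofCoords 1 (0, 0)) = realOuter ![0, 1, 0] := by
  rw [emb_ofCoords_zero]
  congr 1
  funext a
  fin_cases a <;> rfl

theorem emb_ofCoords_zero_two : emb (ofCoords 2 (0, 0)) = realOuter ![0, 0, 1] := by
  rw [emb_ofCoords_zero]
  congr 1
  funext a
  fin_cases a <;> rfl

theorem IsRotation.emb_base {t : ℝ} {f : OP2 → OP2} (hf : IsRotation t f) :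
    emb (f (ofCoords 0 (0, 0))) = realOuter ![Real.cos t, -Real.sin t, 0] := by
  obtain ⟨f₁, f₂, h₁, h₂, rfl⟩ := hf
  have h0 : emb (ofCoords 0 (0, 0)) = realOuter ![1, 0, 0] := by
    simpa using emb_ofCoords_tan (θ := 0) (by simp)
  have e : (0 : Octonion) = (0 : ℝ) • 1 := by simp
  rw [Function.comp_apply, h₁.emb_apply one_sq_add_norm_zero_sq,
    h₂.emb_apply (cos_sq_add_norm_sin_sq t), h0,
    reflectionMatrix_realOuter 2 (Real.cos_sq_add_sin_sq t), e,
    reflectionMatrix_realOuter 2 (by norm_num)]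
  congr 1
  funext a
  fin_cases a <;> simp [Fin.succAbove] <;> rfl

theorem IsRotation.apply_ofCoords_two {t : ℝ} {f : OP2 → OP2} (hf : IsRotation t f)
    (u v : Octonion) : f (ofCoords 2 (u, v)) = ofCoords 2
      (Real.cos t • u + Real.sin t • v, -(Real.sin t • u) + Real.cos t • v) := by
  obtain ⟨f₁, f₂, h₁, h₂, rfl⟩ := hf
  rw [Function.comp_apply, h₂.2, h₁.2]
  congr 1
  simp [reflectionCoords, one_mul', smul_mul_assoc, sub_eq_neg_add, add_comm]

/-- Points to which a composition of reflections of the first chart and rotations takes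
`[1, 0, 0]`. -/
def Reachable (p : OP2) : Prop := ∃ f : OP2 → OP2, IsComposite f ∧ f (ofCoords 0 (0, 0)) = p

theorem Reachable.reflection {p : OP2} (hp : Reachable p) {r : ℝ} {lam : Octonion}
    {ρ : OP2 → OP2} (h : r ^ 2 + ‖lam‖ ^ 2 = 1) (hρ : IsGlobalReflection 0 r lam ρ) :
    Reachable (ρ p) := by
  obtain ⟨f, hf, rfl⟩ := hp
  exact ⟨ρ ∘ f, .reflection_comp r lam ρ f h hρ hf, rfl⟩

theorem Reachable.rotation {p : OP2} (hp : Reachable p) {t : ℝ} {ρ : OP2 → OP2}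
    (hρ : IsRotation t ρ) : Reachable (ρ p) := by
  obtain ⟨f, hf, rfl⟩ := hp
  exact ⟨ρ ∘ f, .rotation_comp t ρ f hρ hf, rfl⟩

theorem reachable_base : Reachable (ofCoords 0 (0, 0)) := ⟨id, .refl, rfl⟩

theorem Reachable.reflectionCoords {z : Octonion × Octonion} (hz : Reachable (ofCoords 0 z))
    {r : ℝ} {lam : Octonion} (h : r ^ 2 + ‖lam‖ ^ 2 = 1) :
    Reachable (ofCoords 0 (reflectionCoords r lam z)) := by
  obtain ⟨ρ, hρ⟩ := exists_isGlobalReflection 0 h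
  rw [← hρ.2]
  exact hz.reflection h hρ

/-- The rotation by t takes [1,0,0] to [cos t, -sin t, 0], so t = -arctan x gives slope x. -/
theorem reachable_real (x : ℝ) : Reachable (ofCoords 0 (x • 1, 0)) := by
  obtain ⟨ρ, hρ, -⟩ := existsUnique_isRotation (-Real.arctan x)
  have h : ρ (ofCoords 0 (0, 0)) = ofCoords 0 (x • 1, 0) := by
    apply emb_injective
    have := emb_ofCoords_tan (Real.cos_arctan_pos x).ne'
    rw [Real.tan_arctan] at this
    rw [hρ.emb_base, this, Real.cos_neg, Real.sin_neg, neg_neg]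
  rw [← h]
  exact reachable_base.rotation hρ

theorem exists_norm_smul (b : Octonion) : ∃ w : Octonion, ‖w‖ = 1 ∧ b = ‖b‖ • w := by
  by_cases hb : b = 0
  · exact ⟨1, norm_one', by simp [hb]⟩
  · have h := norm_ne_zero_iff.mpr hb
    refine ⟨‖b‖⁻¹ • b, ?_, ?_⟩
    · rw [norm_smul, norm_inv, norm_norm, inv_mul_cancel₀ h]
    · rw [smul_smul, mul_inv_cancel₀ h, one_smul]

/-- Two reflections move (x, 0), with x² = |a|² + |b|², to (a, b). The intermediate point (0, xw),
with w the direction of b, is chosen so that the second step needs only (a w̄)w = a. -/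
theorem reachable_ofCoords_zero (z : Octonion × Octonion) : Reachable (ofCoords 0 z) := by
  obtain ⟨a, b⟩ := z
  by_cases h0 : ‖a‖ ^ 2 + ‖b‖ ^ 2 = 0
  · have ha : a = 0 := norm_eq_zero.mp (by nlinarith [sq_nonneg ‖a‖, sq_nonneg ‖b‖])
    have hb : b = 0 := norm_eq_zero.mp (by nlinarith [sq_nonneg ‖a‖, sq_nonneg ‖b‖])
    rw [ha, hb]
    exact reachable_base
  obtain ⟨w, hw, hbw⟩ := exists_norm_smul b
  set x := Real.sqrt (‖a‖ ^ 2 + ‖b‖ ^ 2) with hx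
  have hx2 : x ^ 2 = ‖a‖ ^ 2 + ‖b‖ ^ 2 := Real.sq_sqrt (by positivity)
  have hx0 : x ≠ 0 := fun h => h0 (by rw [← hx2, h]; simp)
  -- The reflection with r = 0, λ = w̄ sends (x, 0) to (0, xw). The one with r = -|b|/x, λ = x⁻¹(a
  -- w̄) then sends (0, xw) to ((a w̄)w, |b|w) = (a, b).
  have h₁ : (0 : ℝ) ^ 2 + ‖star w‖ ^ 2 = 1 := by rw [norm_star', hw]; norm_num
  have h₂ : (-(‖b‖ / x)) ^ 2 + ‖x⁻¹ • (a * star w)‖ ^ 2 = 1 := by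
    rw [norm_smul, norm_mul', norm_star', hw, mul_one, mul_pow, norm_inv, Real.norm_eq_abs,
      inv_pow, sq_abs]
    field_simp
    linarith
  have h := ((reachable_real x).reflectionCoords h₁).reflectionCoords h₂
  convert h using 2
  refine Prod.ext ?_ ?_
  · simp [OP2.reflectionCoords, mul_one', smul_smul, mul_star_mul, hw, hx0, smul_mul_assoc,
      mul_smul_comm]
  · have hbx : (‖b‖ / x) • (x • w) = b := by
      rw [smul_smul, div_mul_cancel₀ _ hx0, ← hbw]
    simp [OP2.reflectionCoords, mul_one', mul_smul_comm, hbx]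

theorem ofCoords_mem_source_iff (i j : Fin 3) (z : Octonion × Octonion) :
    ofCoords i z ∈ (chart j).source ↔ affine i z j ≠ 0 := proj_mem_range

theorem reachable (p : OP2) : Reachable p := by
  have hchart {q : OP2} (hq : q ∈ (chart 0).source) : Reachable q := by
    rw [← ofCoords_coords hq]
    exact reachable_ofCoords_zero _
  by_cases h0 : p ∈ (chart 0).source
  · exact hchart h0
  have hone : Reachable (ofCoords 1 (0, 0)) := by
    obtain ⟨ρ, hρ, -⟩ := existsUnique_isRotation (-(Real.pi / 2))
    have h : ρ (ofCoords 0 (0, 0)) = ofCoords 1 (0, 0) := by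
      apply emb_injective
      rw [hρ.emb_base, emb_ofCoords_zero_one]
      simp
    rw [← h]
    exact reachable_base.rotation hρ
  have htwo : Reachable (ofCoords 2 (0, 0)) := by
    -- With r = 0 and λ = 1 the reflection swaps the last two entries, taking [0,1,0] to [0,0,1].
    have hl : (0 : ℝ) ^ 2 + ‖(1 : ℝ) • (1 : Octonion)‖ ^ 2 = 1 := by simp
    obtain ⟨ρ, hρ⟩ := exists_isGlobalReflection 0 hl
    have h : ρ (ofCoords 1 (0, 0)) = ofCoords 2 (0, 0) := by
      apply emb_injective
      rw [hρ.emb_apply hl, emb_ofCoords_zero_one, emb_ofCoords_zero_two,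
        reflectionMatrix_realOuter 0 (by norm_num)]
      congr 1
      funext a
      fin_cases a <;> simp [Fin.succAbove]
    rw [← h]
    exact hone.reflection hl hρ
  by_cases h2 : p ∈ (chart 2).source
  · obtain ⟨⟨u, v⟩, rfl⟩ := h2
    have hu : u = 0 := by
      rw [ofCoords_mem_source_iff, not_not] at h0
      exact h0
    subst hu
    by_cases hv : v = 0
    · rw [hv]
      exact htwo
    obtain ⟨ρ, hρ, -⟩ := existsUnique_isRotation (-(Real.pi / 2))
    -- For v ≠ 0 the point [v,0,1] lies in U₁, and the rotation by -π/2 takes it to [0,v,1].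
    have hq : Reachable (ofCoords 2 (v, 0)) :=
      hchart ((ofCoords_mem_source_iff _ _ _).mpr hv)
    have h := hρ.apply_ofCoords_two v 0
    simp only [Real.cos_neg, Real.cos_pi_div_two, Real.sin_neg, Real.sin_pi_div_two, zero_smul,
      smul_zero, add_zero, neg_smul, neg_neg, one_smul] at h
    rw [← h]
    exact hq.rotation hρ
  · obtain ⟨i, hi⟩ := exists_mem_source p
    have h1 : i = 1 := by
      fin_cases i
      · exact absurd hi h0
      · rfl
      · exact absurd hi h2
    subst h1
    obtain ⟨⟨u, v⟩, rfl⟩ := hi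
    -- A point outside U₁ and U₃ has first and last entries 0, so it is [0,1,0].
    rw [ofCoords_mem_source_iff, not_not] at h0 h2
    have hu : u = 0 := h0
    have hv : v = 0 := h2
    rw [hu, hv]
    exact hone

theorem IsOctonionicMetric.isHomogeneous {g : SmoothMetric} (hg : IsOctonionicMetric g) :
    IsHomogeneous g := by
  intro p q
  obtain ⟨f, hf, rfl⟩ := reachable p
  obtain ⟨f', hf', rfl⟩ := reachable q
  obtain ⟨k, hk, hkf⟩ := (hf.isRiemannianIsometry hg).exists_inverse
  exact ⟨f' ∘ k, (hf'.isRiemannianIsometry hg).comp hk, congrArg f' (hkf _)⟩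

end OP2

end

theorem mainTheorem1 :
    (∃! g : OP2.SmoothMetric, OP2.IsOctonionicMetric g) ∧
    (∀ (i : Fin 3) (r : ℝ) (lam : Octonion), r ^ 2 + ‖lam‖ ^ 2 = 1 →
      ∃! f : OP2 → OP2, OP2.IsGlobalReflection i r lam f) ∧
    (∀ t : ℝ, ∃! f : OP2 → OP2, OP2.IsRotation t f) ∧
    ∀ g : OP2.SmoothMetric, OP2.IsOctonionicMetric g →
      OP2.IsHomogeneous g ∧
      (∀ (i : Fin 3) (r : ℝ) (lam : Octonion) (f : OP2 → OP2), r ^ 2 + ‖lam‖ ^ 2 = 1 →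
        OP2.IsGlobalReflection i r lam f →
          OP2.IsRiemannianIsometry g f ∧ Function.Involutive f) ∧
      (∀ f : OP2 → OP2, OP2.IsComposite f → OP2.IsRiemannianIsometry g f) ∧
      (∀ p : OP2, ∃ f : OP2 → OP2, OP2.IsComposite f ∧ f (OP2.ofCoords 0 (0, 0)) = p) := by
  refine ⟨OP2.existsUnique_isOctonionicMetric, fun i r lam h => ?_, OP2.existsUnique_isRotation,
    fun g hg => ⟨hg.isHomogeneous, fun i r lam f h hf =>
      ⟨hf.isRiemannianIsometry hg h, hf.involutive h⟩,
      fun f hf => hf.isRiemannianIsometry hg, OP2.reachable⟩⟩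
  obtain ⟨f, hf⟩ := OP2.exists_isGlobalReflection i h
  exact ⟨f, hf, fun f' hf' => hf'.unique hf⟩
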